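/- Let $\mathbb{D}$ be the open unit disk and $dA$ normalized area measure on $\mathbb{D}$. For $\gamma>-2$ let $A^2_\gamma$ be the space of analytic functions $f$ on $\mathbb{D}$ with $\int_{\mathbb{D}}(1-|z|^2)^{2k}|f^{(k)}(z)|^2(1-|z|^2)^{\gamma}\,dA(z)<\infty$, where $k\ge 0$ is any integer with $2k+\gamma>-1$ (the space does not depend on the choice of $k$). For $\alpha>-1$, regard $A^2_\alpha$ as a Hilbert space with the inner product $\langle f,g\rangle=(\alpha+1)\int_{\mathbb{D}} f\,\overline{g}\,(1-|z|^2)^{\alpha}\,dA(z)$. **Theorem.** Let $\alpha>-1$, and let $\varphi$ be an analytic function on $\mathbb{D}$ with $|\varphi|\le 1$ that is not a constant of modulus one. Let $T_\varphi$ be the operator of multiplication by $\varphi$ on $A^2_\alpha$, let $D_{\overline\varphi}=(I-T_\varphi^*T_\varphi)^{1/2}$, and let $H^\alpha(\overline\varphi)=D_{\overline\varphi}(A^2_\alpha)$ be the range of $D_{\overline\varphi}$. Then the following conditions are equivalent: (a) the operator $D_{\overline\varphi}$ is compact on $A^2_\alpha$; (b) $\varphi$ is a finite Blaschke product, that is,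 $\varphi(z)=c\prod_{j=1}^n\frac{z-a_j}{1-\overline{a_j}z}$ with $|c|=1$ and $a_1,\dots,a_n\in\mathbb{D}$; (c) $H^\alpha(\overline\varphi)=A^2_{\alpha-1}$, as sets of functions; (d) $H^\alpha(\overline\varphi)\subseteq A^2_{\alpha-1}$. -/

import Mathlib

open MeasureTheory Metric Set Filter Topology
open scoped ENNReal

namespace SubBergman

noncomputable section

/-! ### Weighted Bergman spaces on the unit disk -/

/-- The normalized weighted area measure `dA_α(z) = (α + 1) (1 - |z|²)^α dA(z)` on the open unit
disk, where `dA` is area measure divided by `π`; it is used for `α > -1`. -/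
def bergmanMeasure (α : ℝ) : Measure ℂ :=
  (volume.restrict (ball (0 : ℂ) 1)).withDensity
    fun z => ENNReal.ofReal ((α + 1) / Real.pi * (1 - ‖z‖ ^ 2) ^ α)

/-- The space `A²_γ` of analytic functions `f` on the unit disk with
`∫ (1 - |z|²)^(2k) |f^(k)(z)|² (1 - |z|²)^γ dA(z) < ∞`, where `k` is a nonnegative integer with
`2k + γ > -1` (the space does not depend on the choice of such a `k`). Only the values on the open
unit disk matter. -/
def genBergman (γ : ℝ) (k : ℕ) : Set (ℂ → ℂ) :=
  {f | DifferentiableOn ℂ f (ball 0 1) ∧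
    IntegrableOn (fun z => (1 - ‖z‖ ^ 2) ^ (2 * k) * ‖iteratedDeriv k f z‖ ^ 2 * (1 - ‖z‖ ^ 2) ^ γ)
      (ball 0 1)}

/-- For `α > -1`, the space `A²_α` as a subspace of `L²(dA_α)`, with the inner product of
`L²(dA_α)`: the classes that have a representative which is analytic on the unit disk. -/
def bergmanSpace (α : ℝ) : Submodule ℂ (Lp ℂ 2 (bergmanMeasure α)) where
  carrier := {f | ∃ g : ℂ → ℂ, DifferentiableOn ℂ g (ball 0 1) ∧ f =ᵐ[bergmanMeasure α] g}
  add_mem' := by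
    rintro f₁ f₂ ⟨g₁, h₁, e₁⟩ ⟨g₂, h₂, e₂⟩
    exact ⟨g₁ + g₂, h₁.add h₂, (Lp.coeFn_add f₁ f₂).trans (e₁.add e₂)⟩
  zero_mem' := ⟨0, differentiableOn_const 0, Lp.coeFn_zero _ _ _⟩
  smul_mem' := by
    rintro c f ⟨g, h, e⟩
    exact ⟨c • g, h.const_smul c, (Lp.coeFn_smul c f).trans (e.const_smul c)⟩

/-! ### Completeness of `A²_α` -/

/-- A form of the mean value inequality. -/
theorem mean_value_zero {h : ℂ → ℂ} {R : ℝ} (hh : DifferentiableOn ℂ h (ball 0 R)) :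
    (∫⁻ r in Ioo 0 R, ENNReal.ofReal r) * ‖h 0‖ₑ ≤ ∫⁻ w in ball 0 R, ‖h w‖ₑ := by
  set F : ℂ → ℝ≥0∞ := (ball 0 R).indicator fun w => ‖h w‖ₑ with hF
  have hFm : Measurable F := by
    classical
    rw [hF, ← Set.piecewise_eq_indicator]
    exact (hh.continuousOn.enorm).measurable_piecewise continuousOn_const measurableSet_ball
  have key : ∀ r ∈ Ioo 0 R, ‖h 0‖ₑ ≤
      ∫⁻ θ in Ioo (-Real.pi) Real.pi, F (Complex.polarCoord.symm (r, θ)) := by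
    intro r hr
    have hcl : closedBall (0 : ℂ) |r| ⊆ ball 0 R := by
      rw [abs_of_pos hr.1]; exact closedBall_subset_ball hr.2
    have hd : DiffContOnCl ℂ h (ball 0 |r|) := (hh.mono (by
      rw [closure_ball _ (abs_pos.2 hr.1.ne').ne']; exact hcl)).diffContOnCl
    have h1 := hd.circleAverage
    rw [Real.circleAverage_eq_integral_add (-Real.pi),
      intervalIntegral.integral_comp_add_right (fun θ => h (circleMap 0 r θ)),
      intervalIntegral.integral_of_le (by linarith [Real.pi_pos]),
      show 0 + -Real.pi = -Real.pi by ring, show 2 * Real.pi + -Real.pi = Real.pi by ring,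
      ← restrict_Ioo_eq_restrict_Ioc] at h1
    have h2 : ‖(2 * Real.pi)⁻¹‖ₑ ≤ 1 := by
      rw [← ofReal_norm, ENNReal.ofReal_le_one, Real.norm_eq_abs,
        abs_of_pos (by have := Real.pi_pos; positivity)]
      exact inv_le_one_of_one_le₀ (by linarith [Real.pi_gt_three])
    calc ‖h 0‖ₑ = ‖(2 * Real.pi)⁻¹‖ₑ *
          ‖∫ θ in Ioo (-Real.pi) Real.pi, h (circleMap 0 r θ)‖ₑ := by rw [← h1, enorm_smul]
      _ ≤ 1 * ∫⁻ θ in Ioo (-Real.pi) Real.pi, ‖h (circleMap 0 r θ)‖ₑ :=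
          mul_le_mul' h2 (enorm_integral_le_lintegral_enorm _)
      _ = _ := by
          rw [one_mul]
          refine setLIntegral_congr_fun measurableSet_Ioo fun θ _ => ?_
          have e : Complex.polarCoord.symm (r, θ) = circleMap 0 r θ := by
            rw [Complex.polarCoord_symm_apply, circleMap_zero, Complex.exp_mul_I]
            simp
          have hm : circleMap 0 r θ ∈ ball (0 : ℂ) R := by
            simpa [abs_of_pos hr.1] using hr.2
          rw [e, hF, indicator_of_mem hm]
  rw [← lintegral_indicator measurableSet_ball, ← hF, ← Complex.lintegral_comp_polarCoord_symm,
    polarCoord_target, Measure.volume_eq_prod, setLIntegral_prod]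
  · calc (∫⁻ r in Ioo 0 R, ENNReal.ofReal r) * ‖h 0‖ₑ
        = ∫⁻ r in Ioo 0 R, ENNReal.ofReal r * ‖h 0‖ₑ :=
          (lintegral_mul_const _ ENNReal.measurable_ofReal).symm
      _ ≤ ∫⁻ r in Ioo 0 R, ∫⁻ θ in Ioo (-Real.pi) Real.pi,
            ENNReal.ofReal r • F (Complex.polarCoord.symm (r, θ)) := by
          refine setLIntegral_mono' measurableSet_Ioo fun r hr => ?_
          simp only [smul_eq_mul]
          rw [lintegral_const_mul']
          · gcongr
            exact key r hr
          · exact ENNReal.ofReal_ne_top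
      _ ≤ _ := lintegral_mono_set Ioo_subset_Ioi_self
  · have hs : Measurable Complex.polarCoord.symm := by
      have : (Complex.polarCoord.symm : ℝ × ℝ → ℂ) =
          fun p : ℝ × ℝ => (p.1 : ℂ) * (Real.cos p.2 + Real.sin p.2 * Complex.I) :=
        funext Complex.polarCoord_symm_apply
      rw [this]
      fun_prop
    exact ((ENNReal.measurable_ofReal.comp measurable_fst).smul (hFm.comp hs)).aemeasurable

theorem mean_value {h : ℂ → ℂ} {z : ℂ} {R : ℝ} (hh : DifferentiableOn ℂ h (ball z R)) :
    (∫⁻ r in Ioo 0 R, ENNReal.ofReal r) * ‖h z‖ₑ ≤ ∫⁻ w in ball z R, ‖h w‖ₑ := by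
  have hmap : MapsTo (fun w : ℂ => z + w) (ball 0 R) (ball z R) := by
    intro w hw; simpa [dist_eq_norm] using hw
  have h1 := mean_value_zero (h := fun w => h (z + w)) (R := R)
    (hh.comp (by fun_prop) hmap)
  have h2 := (measurePreserving_add_left (volume : Measure ℂ) z).setLIntegral_comp_preimage_emb
    (measurableEmbedding_addLeft z) (fun w => ‖h w‖ₑ) (ball z R)
  have h3 : (fun w : ℂ => z + w) ⁻¹' ball z R = ball 0 R := by
    ext w; simp [dist_eq_norm]
  rw [h3] at h2
  simpa [← h2] using h1

theorem lintegral_Ioo_pos {R : ℝ} (hR : 0 < R) : (∫⁻ r in Ioo 0 R, ENNReal.ofReal r) ≠ 0 := by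
  rw [← pos_iff_ne_zero, setLIntegral_pos_iff ENNReal.measurable_ofReal]
  have : Function.support (fun r : ℝ => ENNReal.ofReal r) ∩ Ioo 0 R = Ioo 0 R := by
    ext r; simp +contextual
  simpa [this] using hR

/-- Point evaluations are bounded on `A²_α`, locally uniformly. -/
theorem eval_bound {α ρ : ℝ} (hα : -1 < α) (hρ : 0 < ρ) (hρ1 : ρ < 1) :
    ∃ c : ℝ≥0∞, c ≠ 0 ∧ c ≠ ⊤ ∧ ∀ g : ℂ → ℂ, DifferentiableOn ℂ g (ball 0 1) →
      ∀ z ∈ ball (0 : ℂ) ρ, c * ‖g z‖ₑ ≤ eLpNorm g 2 (bergmanMeasure α) := by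
  obtain ⟨m, hm, hmw⟩ : ∃ m : ℝ, 0 < m ∧ ∀ w ∈ closedBall (0 : ℂ) ((1 + ρ) / 2),
      m ≤ (α + 1) / Real.pi * (1 - ‖w‖ ^ 2) ^ α := by
    have hpos : ∀ w ∈ closedBall (0 : ℂ) ((1 + ρ) / 2), 0 < 1 - ‖w‖ ^ 2 := by
      intro w hw
      have : ‖w‖ ≤ (1 + ρ) / 2 := by simpa using hw
      nlinarith [norm_nonneg w]
    obtain ⟨w₀, hw₀, hmin⟩ := (isCompact_closedBall (0 : ℂ) ((1 + ρ) / 2)).exists_isMinOn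
      ⟨0, by simp; linarith⟩
      (f := fun w : ℂ => (α + 1) / Real.pi * (1 - ‖w‖ ^ 2) ^ α)
      (continuousOn_const.mul (ContinuousOn.rpow_const (by fun_prop)
        fun w hw => Or.inl (hpos w hw).ne'))
    refine ⟨_, ?_, fun w hw => hmin hw⟩
    have := Real.rpow_pos_of_pos (hpos w₀ hw₀) α
    have : 0 < α + 1 := by linarith
    have := Real.pi_pos
    positivity
  set R := (1 - ρ) / 2 with hR
  have hRpos : 0 < R := by rw [hR]; linarith
  refine ⟨min 1 (ENNReal.ofReal m * ∫⁻ r in Ioo 0 R, ENNReal.ofReal r), ?_, ?_, ?_⟩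
  · rw [← pos_iff_ne_zero, lt_min_iff]
    refine ⟨one_pos, ENNReal.mul_pos ?_ (lintegral_Ioo_pos hRpos)⟩
    simpa using hm
  · exact ne_top_of_le_ne_top ENNReal.one_ne_top (min_le_left _ _)
  · intro g hg z hz
    have hz' : ‖z‖ < ρ := by simpa using hz
    have hsub : ball z R ⊆ closedBall (0 : ℂ) ((1 + ρ) / 2) := by
      intro w hw
      have h1 : ‖w - z‖ < R := by simpa [dist_eq_norm] using hw
      have h2 : ‖w‖ ≤ ‖w - z‖ + ‖z‖ := by simpa using norm_add_le (w - z) z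
      rw [mem_closedBall, dist_zero_right]
      linarith
    have hsub1 : ball z R ⊆ ball (0 : ℂ) 1 :=
      hsub.trans (closedBall_subset_ball (by linarith))
    have e2 : eLpNorm g 2 (bergmanMeasure α) ^ 2 = ∫⁻ w, ‖g w‖ₑ ^ 2 ∂(bergmanMeasure α) := by
      rw [eLpNorm_eq_lintegral_rpow_enorm_toReal (by norm_num) (by norm_num),
        ← ENNReal.rpow_natCast, ← ENNReal.rpow_mul]
      simp
    have hmeas : Measurable fun w : ℂ =>
        ENNReal.ofReal ((α + 1) / Real.pi * (1 - ‖w‖ ^ 2) ^ α) := by fun_prop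
    have mv := mean_value (h := fun w => g w ^ 2) (z := z) (R := R) ((hg.mono hsub1).pow 2)
    simp only [enorm_pow] at mv
    refine (ENNReal.pow_le_pow_left_iff two_ne_zero).1 ?_
    rw [mul_pow]
    calc min 1 (ENNReal.ofReal m * ∫⁻ r in Ioo 0 R, ENNReal.ofReal r) ^ 2 * ‖g z‖ₑ ^ 2
        ≤ min 1 (ENNReal.ofReal m * ∫⁻ r in Ioo 0 R, ENNReal.ofReal r) * ‖g z‖ₑ ^ 2 := by
          gcongr; exact pow_le_of_le_one zero_le (min_le_left _ _) two_ne_zero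
      _ ≤ (ENNReal.ofReal m * ∫⁻ r in Ioo 0 R, ENNReal.ofReal r) * ‖g z‖ₑ ^ 2 := by
          gcongr; exact min_le_right _ _
      _ ≤ ENNReal.ofReal m * ∫⁻ w in ball z R, ‖g w‖ₑ ^ 2 := by
          rw [mul_assoc]; gcongr
      _ = ∫⁻ w in ball z R, ENNReal.ofReal m * ‖g w‖ₑ ^ 2 := by
          rw [lintegral_const_mul' _ _ ENNReal.ofReal_ne_top]
      _ ≤ ∫⁻ w in ball z R, ENNReal.ofReal ((α + 1) / Real.pi * (1 - ‖w‖ ^ 2) ^ α) *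
            ‖g w‖ₑ ^ 2 := by
          refine setLIntegral_mono' measurableSet_ball fun w hw => ?_
          gcongr
          exact hmw w (hsub hw)
      _ ≤ ∫⁻ w in ball 0 1, ENNReal.ofReal ((α + 1) / Real.pi * (1 - ‖w‖ ^ 2) ^ α) *
            ‖g w‖ₑ ^ 2 := lintegral_mono_set hsub1
      _ = _ := by
          rw [e2, bergmanMeasure, lintegral_withDensity_eq_lintegral_mul_non_measurable₀ _
            hmeas.aemeasurable (by simp)]
          rfl

theorem bergmanMeasure_of_le {α : ℝ} (hα : α ≤ -1) : bergmanMeasure α = 0 := by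
  rw [bergmanMeasure, withDensity_eq_zero_iff (by fun_prop)]
  rw [EventuallyEq, ae_restrict_iff' measurableSet_ball]
  refine ae_of_all _ fun w hw => ?_
  have h1 : ‖w‖ < 1 := by simpa using hw
  have h2 : 0 ≤ (1 - ‖w‖ ^ 2) ^ α := Real.rpow_nonneg (by nlinarith [norm_nonneg w]) _
  have h3 : (α + 1) / Real.pi ≤ 0 := div_nonpos_of_nonpos_of_nonneg (by linarith) Real.pi_pos.le
  simpa using mul_nonpos_of_nonpos_of_nonneg h3 h2

theorem ae_bergmanMeasure_mem (α : ℝ) : ∀ᵐ w ∂(bergmanMeasure α), w ∈ ball (0 : ℂ) 1 :=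
  (withDensity_absolutelyContinuous _ _).ae_le (ae_restrict_mem measurableSet_ball)

theorem isClosed_bergmanSpace (α : ℝ) :
    IsClosed (bergmanSpace α : Set (Lp ℂ 2 (bergmanMeasure α))) := by
  rcases le_or_gt α (-1) with hα | hα
  · convert isClosed_univ
    refine eq_univ_of_forall fun f => ⟨0, differentiableOn_const 0, ?_⟩
    have h0 : ae (bergmanMeasure α) = ⊥ := by rw [bergmanMeasure_of_le hα, ae_zero]
    simp [EventuallyEq, h0]
  refine IsSeqClosed.isClosed fun u f hu huf => ?_
  choose g hg hug using hu
  have hdist : ∀ i j, eLpNorm (g i - g j) 2 (bergmanMeasure α) = edist (u i) (u j) := by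
    intro i j
    rw [Lp.edist_def]
    exact eLpNorm_congr_ae ((hug i).symm.sub (hug j).symm)
  have hcau : ∀ ρ, 0 < ρ → ρ < 1 → UniformCauchySeqOn g atTop (ball 0 ρ) := by
    intro ρ h0 h1
    obtain ⟨c, hc0, hct, hc⟩ := eval_bound hα h0 h1
    rw [Metric.uniformCauchySeqOn_iff]
    intro ε hε
    have hδ : 0 < c * ENNReal.ofReal ε := ENNReal.mul_pos hc0 (by simpa using hε)
    obtain ⟨N, hN⟩ := EMetric.cauchySeq_iff.1 huf.cauchySeq _ hδ
    refine ⟨N, fun i hi j hj z hz => ?_⟩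
    have h1 := (hc _ ((hg i).sub (hg j)) z hz).trans_lt ((hdist i j).trans_lt (hN i hi j hj))
    have h2 := (ENNReal.mul_lt_mul_iff_right hc0 hct).1 h1
    rw [← edist_lt_ofReal, edist_eq_enorm_sub]
    exact h2
  have hpt : ∀ z ∈ ball (0 : ℂ) 1, ∃ y, Tendsto (fun n => g n z) atTop (𝓝 y) := by
    intro z hz
    have hz' : ‖z‖ < 1 := by simpa using hz
    refine cauchySeq_tendsto_of_complete ((hcau ((1 + ‖z‖) / 2) ?_ ?_).cauchySeq (x := z) ?_)
    · linarith [norm_nonneg z]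
    · linarith
    · rw [mem_ball, dist_zero_right]; linarith
  choose! G hG using hpt
  have hGd : DifferentiableOn ℂ G (ball 0 1) := by
    have : TendstoLocallyUniformlyOn g G atTop (ball 0 1) := by
      rw [tendstoLocallyUniformlyOn_iff_forall_isCompact isOpen_ball]
      intro K hK hKc
      obtain ⟨ρ, ⟨hρ, hρ1⟩, hKρ⟩ := exists_pos_lt_subset_ball one_pos hKc.isClosed hK
      exact ((hcau ρ hρ hρ1).mono hKρ).tendstoUniformlyOn_of_tendsto fun z hz => hG z (hK hz)
    exact this.differentiableOn (Eventually.of_forall hg) isOpen_ball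
  refine ⟨G, hGd, ?_⟩
  obtain ⟨ns, hns, hae⟩ := (tendstoInMeasure_of_tendsto_Lp huf).exists_seq_tendsto_ae
  filter_upwards [hae, ae_bergmanMeasure_mem α, ae_all_iff.2 hug] with z h1 h2 h3
  refine tendsto_nhds_unique h1 ?_
  simp only [h3]
  exact (hG z h2).comp hns.tendsto_atTop

instance (α : ℝ) : CompleteSpace (bergmanSpace α) :=
  (isClosed_bergmanSpace α).completeSpace_coe

/-! ### Multiplication operators, defect operators and sub-Bergman spaces -/

/-- The closed unit ball of `H^∞`: analytic functions on the unit disk bounded by one. -/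
def hInftyBall : Set (ℂ → ℂ) :=
  {φ | DifferentiableOn ℂ φ (ball 0 1) ∧ ∀ z ∈ ball (0 : ℂ) 1, ‖φ z‖ ≤ 1}

theorem eLpNorm_mul_le {α : ℝ} {φ : ℂ → ℂ} (hφ : φ ∈ hInftyBall) (f : ℂ → ℂ) :
    eLpNorm (fun z => φ z * f z) 2 (bergmanMeasure α) ≤ eLpNorm f 2 (bergmanMeasure α) := by
  refine eLpNorm_mono_ae ?_
  filter_upwards [ae_bergmanMeasure_mem α] with z hz
  rw [norm_mul]
  exact mul_le_of_le_one_left (norm_nonneg _) (hφ.2 z hz)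

theorem memLp_mul {α : ℝ} {φ : ℂ → ℂ} (hφ : φ ∈ hInftyBall)
    (f : Lp ℂ 2 (bergmanMeasure α)) : MemLp (fun z => φ z * f z) 2 (bergmanMeasure α) := by
  have hm : AEStronglyMeasurable φ (bergmanMeasure α) :=
    (hφ.1.continuousOn.aestronglyMeasurable measurableSet_ball).mono_ac
      (withDensity_absolutelyContinuous _ _)
  exact ⟨hm.mul (Lp.aestronglyMeasurable f),
    (eLpNorm_mul_le hφ f).trans_lt (Lp.memLp f).2⟩

/-- The operator `T_φ` of multiplication by `φ` on `A²_α`, for `φ` in the closed unit ball of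
`H^∞`. -/
def mulOp (α : ℝ) {φ : ℂ → ℂ} (hφ : φ ∈ hInftyBall) : bergmanSpace α →L[ℂ] bergmanSpace α :=
  LinearMap.mkContinuous
    { toFun := fun f => ⟨(memLp_mul hφ f.1).toLp _, by
        obtain ⟨g, hg, hfg⟩ := f.2
        refine ⟨fun z => φ z * g z, hφ.1.mul hg, (MemLp.coeFn_toLp _).trans ?_⟩
        filter_upwards [hfg] with z hz
        rw [hz]⟩
      map_add' := fun f g => by
        refine Subtype.ext ((MemLp.toLp_congr (memLp_mul hφ (f + g).1)
          ((memLp_mul hφ f.1).add (memLp_mul hφ g.1)) ?_).trans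
          (MemLp.toLp_add (memLp_mul hφ f.1) (memLp_mul hφ g.1)))
        filter_upwards [Lp.coeFn_add f.1 g.1] with z hz
        rw [Submodule.coe_add, hz]
        exact mul_add _ _ _
      map_smul' := fun c f => by
        refine Subtype.ext ((MemLp.toLp_congr (memLp_mul hφ (c • f).1)
          ((memLp_mul hφ f.1).const_smul c) ?_).trans
          (MemLp.toLp_const_smul c (memLp_mul hφ f.1)))
        filter_upwards [Lp.coeFn_smul c f.1] with z hz
        rw [Submodule.coe_smul, hz]
        exact mul_left_comm _ _ _ }
    1 fun f => by
      rw [one_mul]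
      change ‖(memLp_mul hφ f.1).toLp _‖ ≤ ‖f.1‖
      rw [Lp.norm_toLp, Lp.norm_def]
      exact ENNReal.toReal_mono (Lp.memLp f.1).2.ne (eLpNorm_mul_le hφ _)

/-- The operator `(I - T* T)^{1/2}` for a contraction `T` on a Hilbert space. -/
def defectOp {H : Type*} [NormedAddCommGroup H] [InnerProductSpace ℂ H] [CompleteSpace H]
    (T : H →L[ℂ] H) : H →L[ℂ] H :=
  CFC.sqrt (1 - T.adjoint * T)

/-- The defect operator `D_φ̄ = (I - T_φ* T_φ)^{1/2}` on `A²_α`. -/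
def defectConj (α : ℝ) {φ : ℂ → ℂ} (hφ : φ ∈ hInftyBall) :
    bergmanSpace α →L[ℂ] bergmanSpace α :=
  defectOp (mulOp α hφ)

/-- The sub-Bergman space `H^α(φ̄)`, the range of the defect operator `D_φ̄`, as a space of analytic
functions on the unit disk: an analytic function belongs to it when its class is in that range. Only
the values on the open unit disk matter. -/
def subBergmanConj (α : ℝ) {φ : ℂ → ℂ} (hφ : φ ∈ hInftyBall) : Set (ℂ → ℂ) :=
  {f | DifferentiableOn ℂ f (ball 0 1) ∧ ∃ g : bergmanSpace α,
    (defectConj α hφ g).1 =ᵐ[bergmanMeasure α] f}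

/-- Finite Blaschke products: `φ(z) = c ∏ (z - a_j) / (1 - conj(a_j) z)` on the unit disk, with
`|c| = 1` and finitely many `a_j` in the unit disk. -/
def IsFiniteBlaschke (φ : ℂ → ℂ) : Prop :=
  ∃ (n : ℕ) (a : Fin n → ℂ) (c : ℂ), (∀ j, a j ∈ ball (0 : ℂ) 1) ∧ ‖c‖ = 1 ∧
    ∀ z ∈ ball (0 : ℂ) 1, φ z = c * ∏ j, (z - a j) / (1 - star (a j) * z)

end

end SubBergman

open MeasureTheory Metric Set Filter Topology
open scoped ENNReal

namespace SubBergman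

noncomputable section

/-! ### The Schwarz–Pick lemma and finite Blaschke products -/

/-! Everything rests on the formula `‖D f‖² = ‖f‖² - ‖φ f‖² = ∫ |f|² (1 - |φ|²) dA_α` for the defect
operator `D` (`ofReal_norm_defectConj_sq`). Since `D` is self-adjoint, `g` is in its range exactly
when `|⟪g, f⟫| ≤ C ‖D f‖` for all `f` (`mem_range_iff_exists_bound`). So the range depends only on
the size of `1 - |φ|²` up to constant factors.

The symbol `z` is the model. There `‖D f‖²` is diagonal in the Taylor coefficients, with factors `(α
+ 1) / (n + α + 2)` relative to `‖f‖²`. Hence this operator is injective and compact, and its range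
is `A²_{α-1}` (`subBergmanConj_id_eq`).

If `φ` is a finite Blaschke product, then `1 - |φ|²` is comparable to `1 - |z|²`: the upper bound
comes factor by factor, the lower one from Schwarz–Pick. So the two ranges coincide. If only the
inclusion of ranges is known, the closed graph theorem factors `D` through the compact model
operator (`isCompactOperator_of_range_subset`).

For compactness to force a Blaschke product, test `D` on normalized reproducing kernels. They tend
weakly to zero at the circle, so a compact `D` sends them to zero in norm. Schwarz–Pick makes `1 -
|φ|²` almost constant from below on a disk about `w` of radius comparable to `1 - |w|`, so the
squared norm of the image is at least `c (1 - |φ(w)|²)`. Therefore `|φ| → 1` at the circle. Such a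
function has finitely many zeros, and dividing them out leaves a unimodular constant
(`isFiniteBlaschke_of_boundaryUnimodular`). -/

theorem norm_one_sub_star_mul_sq_sub (b u : ℂ) :
    ‖1 - star b * u‖ ^ 2 - ‖u - b‖ ^ 2 = (1 - ‖b‖ ^ 2) * (1 - ‖u‖ ^ 2) := by
  simp only [← Complex.normSq_eq_norm_sq, Complex.normSq_apply, Complex.sub_re, Complex.sub_im,
    Complex.mul_re, Complex.mul_im, Complex.star_def, Complex.conj_re, Complex.conj_im,
    Complex.one_re, Complex.one_im]
  ring

theorem one_sub_norm_le_norm_one_sub_star_mul {b u : ℂ} (hu : ‖u‖ ≤ 1) :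
    1 - ‖b‖ ≤ ‖1 - star b * u‖ := by
  have h := norm_sub_norm_le (1 : ℂ) (star b * u)
  rw [norm_one, norm_mul, norm_star] at h
  nlinarith [norm_nonneg b]

theorem one_sub_star_mul_ne_zero {b u : ℂ} (hb : ‖b‖ < 1) (hu : ‖u‖ ≤ 1) :
    1 - star b * u ≠ 0 := by
  have := one_sub_norm_le_norm_one_sub_star_mul (b := b) hu
  exact norm_pos_iff.1 (by linarith)

theorem norm_sub_le_norm_one_sub_star_mul {b u : ℂ} (hb : ‖b‖ ≤ 1) (hu : ‖u‖ ≤ 1) :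
    ‖u - b‖ ≤ ‖1 - star b * u‖ := by
  have h := norm_one_sub_star_mul_sq_sub b u
  have h1 : 0 ≤ (1 - ‖b‖ ^ 2) * (1 - ‖u‖ ^ 2) :=
    mul_nonneg (by nlinarith [norm_nonneg b]) (by nlinarith [norm_nonneg u])
  exact (pow_le_pow_iff_left₀ (norm_nonneg _) (norm_nonneg _) two_ne_zero).1 (by linarith)

/-- The Schwarz–Pick lemma on a ball, centred at its centre. -/
theorem schwarz_pick {φ : ℂ → ℂ} {w z : ℂ} {R : ℝ} (hd : DifferentiableOn ℂ φ (ball w R))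
    (hφ : ∀ z ∈ ball w R, ‖φ z‖ < 1) (hz : z ∈ ball w R) :
    ‖φ z - φ w‖ ≤ ‖z - w‖ / R * ‖1 - star (φ w) * φ z‖ := by
  have hR : 0 < R := pos_of_mem_ball hz
  have hw := hφ w (mem_ball_self hR)
  have hne : ∀ u ∈ ball w R, 1 - star (φ w) * φ u ≠ 0 := fun u hu =>
    one_sub_star_mul_ne_zero hw (hφ u hu).le
  set ψ : ℂ → ℂ := fun u => (φ u - φ w) / (1 - star (φ w) * φ u) with hψ
  have hψw : ψ w = 0 := by simp [hψ]
  have hψd : DifferentiableOn ℂ ψ (ball w R) :=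
    (hd.sub_const _).div ((differentiableOn_const _).sub (hd.const_mul _)) hne
  have hmaps : MapsTo ψ (ball w R) (closedBall (ψ w) 1) := by
    intro u hu
    rw [hψw, mem_closedBall, dist_zero_right, hψ, norm_div]
    exact div_le_one_of_le₀ (norm_sub_le_norm_one_sub_star_mul hw.le (hφ u hu).le) (norm_nonneg _)
  have h := Complex.dist_le_div_mul_dist_of_mapsTo_ball hψd hmaps hz
  rw [hψw, dist_zero_right, dist_eq_norm, hψ, norm_div,
    div_le_iff₀ (norm_pos_iff.2 (hne z hz))] at h
  calc _ ≤ _ := h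
    _ = _ := by ring

/-- With `b = ‖φ w‖`, inserting Schwarz–Pick into the identity for `‖1 - star b * u‖²` gives `(1 -
ρ²)(1 - b)² ≤ (1 - b²)(1 - ‖φ z‖²)`. Cancelling `1 - b` and multiplying by `1 + b` leaves the factor
`(1 + b)² ≤ 4`. The ball is arbitrary because small disks near the circle are needed as well as the
unit disk. -/
theorem le_one_sub_norm_sq_of_mem_ball {φ : ℂ → ℂ} {w z : ℂ} {R : ℝ}
    (hd : DifferentiableOn ℂ φ (ball w R)) (hφ : ∀ z ∈ ball w R, ‖φ z‖ < 1) (hz : z ∈ ball w R) :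
    (1 - (‖z - w‖ / R) ^ 2) * (1 - ‖φ w‖ ^ 2) / 4 ≤ 1 - ‖φ z‖ ^ 2 := by
  have hR : 0 < R := pos_of_mem_ball hz
  have hw := hφ w (mem_ball_self hR)
  have h1 := schwarz_pick hd hφ hz
  have h2 := norm_one_sub_star_mul_sq_sub (φ w) (φ z)
  have h3 := one_sub_norm_le_norm_one_sub_star_mul (b := φ w) (hφ z hz).le
  set ρ := ‖z - w‖ / R with hρ
  have hρ0 : 0 ≤ ρ := by positivity
  have hρ1 : ρ < 1 := by
    rw [hρ, div_lt_one hR]; simpa [dist_eq_norm] using hz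
  set b := ‖φ w‖
  have hb0 : 0 ≤ b := norm_nonneg _
  set N := ‖1 - star (φ w) * φ z‖
  have h4 : ‖φ z - φ w‖ ^ 2 ≤ ρ ^ 2 * N ^ 2 := by
    rw [← mul_pow]; exact pow_le_pow_left₀ (norm_nonneg _) h1 2
  have h5 : (1 - ρ ^ 2) * (1 - b) ^ 2 ≤ (1 - b ^ 2) * (1 - ‖φ z‖ ^ 2) := by
    have h6 : (1 - b) ^ 2 ≤ N ^ 2 := pow_le_pow_left₀ (by linarith) h3 2
    have h7 : (1 - ρ ^ 2) * (1 - b) ^ 2 ≤ (1 - ρ ^ 2) * N ^ 2 :=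
      mul_le_mul_of_nonneg_left h6 (by nlinarith)
    linarith
  have h6 : (1 - ρ ^ 2) * (1 - b) ≤ (1 + b) * (1 - ‖φ z‖ ^ 2) := by
    have hb : 0 < 1 - b := by linarith
    refine le_of_mul_le_mul_left ?_ hb
    nlinarith
  have hx : 0 ≤ 1 - ρ ^ 2 := by nlinarith
  have hy : 0 ≤ 1 - ‖φ z‖ ^ 2 := by nlinarith [norm_nonneg (φ z), hφ z hz]
  have h7 : (1 - ρ ^ 2) * (1 - b) * (1 + b) ≤ (1 + b) * (1 - ‖φ z‖ ^ 2) * (1 + b) := by gcongr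
  have h8 : (1 + b) * (1 + b) ≤ 4 := by nlinarith
  have h9 : (1 + b) * (1 + b) * (1 - ‖φ z‖ ^ 2) ≤ 4 * (1 - ‖φ z‖ ^ 2) := by gcongr
  nlinarith

theorem norm_lt_one_of_not_const {φ : ℂ → ℂ} (hφ : φ ∈ hInftyBall)
    (hne : ¬ ∃ c : ℂ, ‖c‖ = 1 ∧ ∀ z ∈ ball (0 : ℂ) 1, φ z = c) :
    ∀ z ∈ ball (0 : ℂ) 1, ‖φ z‖ < 1 := by
  intro z hz
  refine lt_of_le_of_ne (hφ.2 z hz) fun h1 => hne ⟨φ z, h1, ?_⟩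
  refine Complex.eqOn_of_isPreconnected_of_isMaxOn_norm (convex_ball 0 1).isPreconnected
    isOpen_ball hφ.1 hz fun u hu => ?_
  simpa [h1] using hφ.2 u hu

theorem le_one_sub_norm_sq {φ : ℂ → ℂ} (hφ : φ ∈ hInftyBall)
    (hlt : ∀ z ∈ ball (0 : ℂ) 1, ‖φ z‖ < 1) {z : ℂ} (hz : z ∈ ball (0 : ℂ) 1) :
    (1 - ‖φ 0‖ ^ 2) / 4 * (1 - ‖z‖ ^ 2) ≤ 1 - ‖φ z‖ ^ 2 := by
  have := le_one_sub_norm_sq_of_mem_ball hφ.1 hlt hz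
  simp only [sub_zero, div_one] at this
  linarith

/-! ### Blaschke factors and their finite products. -/

theorem one_sub_prod_le_sum {ι : Type*} (s : Finset ι) (x : ι → ℝ) (h0 : ∀ i ∈ s, 0 ≤ x i)
    (h1 : ∀ i ∈ s, x i ≤ 1) : 1 - ∏ i ∈ s, x i ≤ ∑ i ∈ s, (1 - x i) := by
  classical
  induction s using Finset.induction_on with
  | empty => simp
  | insert i s hi ih =>
    have ih' := ih (fun j hj => h0 j (Finset.mem_insert_of_mem hj))
      fun j hj => h1 j (Finset.mem_insert_of_mem hj)
    have hp : ∏ j ∈ s, x j ≤ 1 := Finset.prod_le_one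
      (fun j hj => h0 j (Finset.mem_insert_of_mem hj))
      fun j hj => h1 j (Finset.mem_insert_of_mem hj)
    have hi1 := h1 i (Finset.mem_insert_self i s)
    rw [Finset.prod_insert hi, Finset.sum_insert hi]
    nlinarith

theorem norm_blaschkeFactor_le_one {a z : ℂ} (ha : ‖a‖ < 1) (hz : ‖z‖ ≤ 1) :
    ‖(z - a) / (1 - star a * z)‖ ≤ 1 := by
  rw [norm_div]
  exact div_le_one_of_le₀ (norm_sub_le_norm_one_sub_star_mul ha.le hz) (norm_nonneg _)

theorem one_sub_norm_blaschkeFactor_sq {a z : ℂ} (ha : ‖a‖ < 1) (hz : ‖z‖ ≤ 1) :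
    1 - ‖(z - a) / (1 - star a * z)‖ ^ 2 =
      (1 - ‖a‖ ^ 2) * (1 - ‖z‖ ^ 2) / ‖1 - star a * z‖ ^ 2 := by
  have h := norm_pos_iff.2 (one_sub_star_mul_ne_zero ha hz)
  rw [← norm_one_sub_star_mul_sq_sub, norm_div, div_pow, sub_div, div_self (by positivity)]

theorem one_sub_norm_blaschkeFactor_sq_le {a z : ℂ} (ha : ‖a‖ < 1) (hz : ‖z‖ ≤ 1) :
    1 - ‖(z - a) / (1 - star a * z)‖ ^ 2 ≤
      (1 - ‖a‖ ^ 2) / (1 - ‖a‖) ^ 2 * (1 - ‖z‖ ^ 2) := by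
  have h := one_sub_norm_le_norm_one_sub_star_mul (b := a) hz
  have h1 : 0 < 1 - ‖a‖ := by linarith
  have h2 : 0 ≤ (1 - ‖a‖ ^ 2) * (1 - ‖z‖ ^ 2) :=
    mul_nonneg (by nlinarith [norm_nonneg a]) (by nlinarith [norm_nonneg z])
  rw [one_sub_norm_blaschkeFactor_sq ha hz, div_mul_eq_mul_div]
  gcongr

/-- The denominator is at most 2 in modulus. The bound keeps factors whose zeros stay in a compact
set uniformly below 1 at a fixed point, which later limits how many zeros can be divided out. -/
theorem le_one_sub_norm_blaschkeFactor_sq {a z : ℂ} (ha : ‖a‖ < 1) (hz : ‖z‖ ≤ 1) :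
    (1 - ‖a‖ ^ 2) * (1 - ‖z‖ ^ 2) / 4 ≤ 1 - ‖(z - a) / (1 - star a * z)‖ ^ 2 := by
  have h := norm_pos_iff.2 (one_sub_star_mul_ne_zero ha hz)
  have h2 : 0 ≤ (1 - ‖a‖ ^ 2) * (1 - ‖z‖ ^ 2) :=
    mul_nonneg (by nlinarith [norm_nonneg a]) (by nlinarith [norm_nonneg z])
  have h3 : ‖1 - star a * z‖ ≤ 2 := by
    refine (norm_sub_le _ _).trans ?_
    rw [norm_one, norm_mul, norm_star]
    nlinarith [norm_nonneg a, norm_nonneg z]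
  rw [one_sub_norm_blaschkeFactor_sq ha hz]
  have h4 : ‖1 - star a * z‖ ^ 2 ≤ 4 := by nlinarith
  gcongr

/-- The defect `1 - ∏ xⱼ` is at most the sum of the defects `1 - xⱼ`, and each single factor has a
defect of order `1 - ‖z‖²`. -/
theorem IsFiniteBlaschke.one_sub_norm_sq_le {φ : ℂ → ℂ} (hφ : IsFiniteBlaschke φ) :
    ∃ C : ℝ, 0 ≤ C ∧ ∀ z ∈ ball (0 : ℂ) 1, 1 - ‖φ z‖ ^ 2 ≤ C * (1 - ‖z‖ ^ 2) := by
  obtain ⟨n, a, c, ha, hc, h⟩ := hφ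
  simp only [mem_ball, dist_zero_right] at ha
  refine ⟨∑ j, (1 - ‖a j‖ ^ 2) / (1 - ‖a j‖) ^ 2, Finset.sum_nonneg fun j _ =>
    div_nonneg (by nlinarith [norm_nonneg (a j), ha j]) (sq_nonneg _), fun z hz => ?_⟩
  have hz' : ‖z‖ ≤ 1 := by simpa using (mem_ball.1 hz).le
  rw [h z hz, norm_mul, hc, one_mul, norm_prod, ← Finset.prod_pow, Finset.sum_mul]
  refine (one_sub_prod_le_sum _ _ (fun j _ => by positivity) fun j _ =>
    pow_le_one₀ (norm_nonneg _) (norm_blaschkeFactor_le_one (ha j) hz')).trans ?_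
  exact Finset.sum_le_sum fun j _ => one_sub_norm_blaschkeFactor_sq_le (ha j) hz'

/-- The modulus of `φ` is eventually at least any number below one, at the unit circle. -/
def BoundaryUnimodular (φ : ℂ → ℂ) : Prop :=
  ∀ ε : ℝ, 0 < ε → ∃ r < 1, ∀ z ∈ ball (0 : ℂ) 1, r < ‖z‖ → 1 - ε < ‖φ z‖

/-- The maximum principle on the disk, for a bound that holds asymptotically at the circle. -/
theorem norm_le_one_of_boundary {χ : ℂ → ℂ} (hd : DifferentiableOn ℂ χ (ball 0 1))
    (hb : ∀ ε : ℝ, 0 < ε → ∃ r < 1, ∀ z ∈ ball (0 : ℂ) 1, r < ‖z‖ → ‖χ z‖ ≤ 1 + ε)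
    {z : ℂ} (hz : z ∈ ball (0 : ℂ) 1) : ‖χ z‖ ≤ 1 := by
  refine le_of_forall_pos_le_add fun ε hε => ?_
  obtain ⟨r, hr, h⟩ := hb ε hε
  have hz' : ‖z‖ < 1 := by simpa using hz
  obtain ⟨s, hs, hs1⟩ := exists_between (max_lt (max_lt hr hz') one_pos)
  have hs0 : 0 < s := (le_max_right _ _).trans_lt hs
  have hsz : ‖z‖ < s := ((le_max_right _ _).trans (le_max_left _ _)).trans_lt hs
  have hsr : r < s := ((le_max_left _ _).trans (le_max_left _ _)).trans_lt hs
  refine Complex.norm_le_of_forall_mem_frontier_norm_le (U := ball 0 s) isBounded_ball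
    (hd.mono ?_).diffContOnCl ?_ (subset_closure (by simpa using hsz))
  · rw [closure_ball _ hs0.ne']
    exact closedBall_subset_ball hs1
  · intro u hu
    rw [frontier_ball _ hs0.ne', mem_sphere, dist_zero_right] at hu
    exact h u (by simpa [hu] using hs1) (by linarith)

theorem IsFiniteBlaschke.blaschkeFactor_mul {χ ψ : ℂ → ℂ} {a : ℂ} (hχ : IsFiniteBlaschke χ)
    (ha : ‖a‖ < 1) (h : ∀ z ∈ ball (0 : ℂ) 1, ψ z = (z - a) / (1 - star a * z) * χ z) :
    IsFiniteBlaschke ψ := by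
  obtain ⟨n, b, c, hb, hc, h'⟩ := hχ
  refine ⟨n + 1, Fin.cons a b, c, fun j => ?_, hc, fun z hz => ?_⟩
  · refine Fin.cases (by simpa using ha) (fun i => by simpa using hb i) j
  · rw [h z hz, h' z hz, Fin.prod_univ_succ]
    simp only [Fin.cons_zero, Fin.cons_succ]
    ring

/-- Without zeros, the maximum principle applies to `1 / ψ` too, so `‖ψ‖ = 1` throughout and `ψ` is
constant: the empty product. -/
theorem isFiniteBlaschke_of_forall_ne_zero {ψ : ℂ → ℂ} (hψ : ψ ∈ hInftyBall)
    (hb : BoundaryUnimodular ψ) (h0 : ∀ z ∈ ball (0 : ℂ) 1, ψ z ≠ 0) : IsFiniteBlaschke ψ := by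
  have hinv : ∀ z ∈ ball (0 : ℂ) 1, ‖(ψ z)⁻¹‖ ≤ 1 := by
    intro z hz
    refine norm_le_one_of_boundary (χ := fun z => (ψ z)⁻¹) (hψ.1.inv h0) (fun ε hε => ?_) hz
    -- Chosen because `1 - ε / (1 + ε) = 1 / (1 + ε)`, whose inverse is the bound wanted.
    obtain ⟨r, hr, h⟩ := hb (ε / (1 + ε)) (by positivity)
    refine ⟨r, hr, fun u hu hru => ?_⟩
    have h1 := h u hu hru
    have h2 : 1 - ε / (1 + ε) = (1 + ε)⁻¹ := by field_simp; ring
    rw [h2] at h1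
    rw [norm_inv]
    exact inv_le_of_inv_le₀ (by positivity) h1.le
  have h1 : ∀ z ∈ ball (0 : ℂ) 1, ‖ψ z‖ = 1 := by
    intro z hz
    have := hinv z hz
    rw [norm_inv, inv_le_one₀ (norm_pos_iff.2 (h0 z hz))] at this
    exact le_antisymm (hψ.2 z hz) this
  have h00 : (0 : ℂ) ∈ ball (0 : ℂ) 1 := by simp
  refine ⟨0, Fin.elim0, ψ 0, fun j => j.elim0, h1 0 h00, fun z hz => ?_⟩
  have := Complex.eqOn_of_isPreconnected_of_isMaxOn_norm (convex_ball (0 : ℂ) 1).isPreconnected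
    isOpen_ball hψ.1 h00 (fun u hu => by simpa [h1 0 h00] using hψ.2 u hu) hz
  simpa using this

theorem boundaryUnimodular_blaschkeFactor {a : ℂ} (ha : ‖a‖ < 1) :
    BoundaryUnimodular fun z => (z - a) / (1 - star a * z) := by
  intro ε hε
  set C := (1 - ‖a‖ ^ 2) / (1 - ‖a‖) ^ 2
  have hC : 0 ≤ C := div_nonneg (by nlinarith [norm_nonneg a]) (sq_nonneg _)
  have hC1 : 0 < 2 * (C + 1) := by positivity
  -- The defect is at most `C (1 - ‖z‖²) ≤ 2 C (1 - ‖z‖)`. Using `C + 1` makes the denominator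
  -- positive from `0 ≤ C` alone.
  refine ⟨1 - ε / (2 * (C + 1)), by linarith [div_pos hε hC1], fun z hz hr => ?_⟩
  have hz' : ‖z‖ < 1 := by simpa using hz
  have h1 := one_sub_norm_blaschkeFactor_sq_le ha hz'.le
  have h2 := norm_blaschkeFactor_le_one ha hz'.le
  set t := ‖(z - a) / (1 - star a * z)‖
  have ht : 0 ≤ t := norm_nonneg _
  have h3 : 1 - ‖z‖ < ε / (2 * (C + 1)) := by linarith
  rw [lt_div_iff₀ hC1] at h3
  have h4 : 1 - ‖z‖ ^ 2 ≤ 2 * (1 - ‖z‖) := by nlinarith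
  have h5 : C * (1 - ‖z‖ ^ 2) ≤ C * (2 * (1 - ‖z‖)) := by gcongr
  have h6 : 1 - t ≤ 1 - t ^ 2 := by nlinarith
  change 1 - ε < t
  nlinarith

/-- Dividing out a zero of a function in the unit ball of `H^∞`. -/
theorem exists_blaschkeFactor_mul {ψ : ℂ → ℂ} (hψ : ψ ∈ hInftyBall) {a : ℂ} (ha : ‖a‖ < 1)
    (h0 : ψ a = 0) : ∃ χ ∈ hInftyBall,
      ∀ z ∈ ball (0 : ℂ) 1, ψ z = (z - a) / (1 - star a * z) * χ z := by
  have ha' : a ∈ ball (0 : ℂ) 1 := by simpa using ha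
  -- `dslope` removes the singularity of `ψ z / (z - a)` at the zero `a`.
  set χ : ℂ → ℂ := fun z => dslope ψ a z * (1 - star a * z) with hχ
  have hχd : DifferentiableOn ℂ χ (ball 0 1) := by
    refine DifferentiableOn.mul ?_ (by fun_prop)
    exact (Complex.differentiableOn_dslope (isOpen_ball.mem_nhds ha')).2 hψ.1
  have hfac : ∀ z ∈ ball (0 : ℂ) 1, ψ z = (z - a) / (1 - star a * z) * χ z := by
    intro z hz
    have hz' : ‖z‖ < 1 := by simpa using hz
    have hne := one_sub_star_mul_ne_zero ha hz'.le
    have h := sub_smul_dslope ψ a z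
    rw [h0, sub_zero, smul_eq_mul] at h
    rw [← h]
    change _ = (z - a) / (1 - star a * z) * (dslope ψ a z * (1 - star a * z))
    rw [mul_comm (dslope ψ a z), ← mul_assoc, div_mul_cancel₀ _ hne]
  refine ⟨χ, ⟨hχd, fun z hz => norm_le_one_of_boundary hχd (fun ε hε => ?_) hz⟩, hfac⟩
  obtain ⟨r, hr, h⟩ := boundaryUnimodular_blaschkeFactor ha (ε / (1 + ε)) (by positivity)
  refine ⟨r, hr, fun u hu hru => ?_⟩
  have h1 := h u hu hru
  have h2 : 1 - ε / (1 + ε) = (1 + ε)⁻¹ := by field_simp; ring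
  rw [h2] at h1
  have h3 := hψ.2 u hu
  rw [hfac u hu, norm_mul] at h3
  have h4 : (1 + ε)⁻¹ * ‖χ u‖ ≤ 1 := le_trans (by gcongr) h3
  rwa [inv_mul_le_iff₀ (by positivity), mul_one] at h4

/-- A function in the unit ball of `H^∞` whose modulus tends to one at the circle is a finite
Blaschke product. -/
theorem isFiniteBlaschke_of_boundaryUnimodular {φ : ℂ → ℂ} (hφ : φ ∈ hInftyBall)
    (hb : BoundaryUnimodular φ) : IsFiniteBlaschke φ := by
  -- Any bound below 1 would do: it confines all zeros to `‖a‖ ≤ r₀`. The point `t` beyond them is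
  -- where moduli are measured, and `q < 1` bounds at `t` every Blaschke factor with `‖a‖ ≤ t`.
  obtain ⟨r₀, hr₀, h₀⟩ := hb (1 / 2) (by norm_num)
  obtain ⟨t, ht, ht1⟩ := exists_between (max_lt hr₀ one_pos)
  have ht0 : 0 < t := (le_max_right _ _).trans_lt ht
  have hrt : r₀ < t := (le_max_left _ _).trans_lt ht
  have hnt : ‖(t : ℂ)‖ = t := by simp [abs_of_pos ht0]
  have htb : (t : ℂ) ∈ ball (0 : ℂ) 1 := by simp [abs_of_pos ht0, ht1]
  set κ := (1 - t ^ 2) * (1 - t ^ 2) / 4 with hκ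
  have hκ0 : 0 < κ := by
    have : 0 < 1 - t ^ 2 := by nlinarith
    positivity
  have hκ1 : κ < 1 := by
    have : (1 - t ^ 2) * (1 - t ^ 2) ≤ 1 := mul_le_one₀ (by nlinarith) (by nlinarith) (by nlinarith)
    linarith
  set q := √(1 - κ) with hq
  have hq0 : 0 < q := Real.sqrt_pos.2 (by linarith)
  have hq1 : q < 1 := by rw [hq, Real.sqrt_lt' one_pos]; linarith
  have hfac : ∀ a : ℂ, ‖a‖ ≤ t → ‖((t : ℂ) - a) / (1 - star a * t)‖ ≤ q := by
    intro a ha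
    have h1 := le_one_sub_norm_blaschkeFactor_sq (a := a) (z := t) (ha.trans_lt ht1)
      (by rw [hnt]; exact ht1.le)
    rw [hnt] at h1
    refine Real.le_sqrt_of_sq_le ?_
    have h2 : κ ≤ (1 - ‖a‖ ^ 2) * (1 - t ^ 2) / 4 := by
      have : ‖a‖ ^ 2 ≤ t ^ 2 := pow_le_pow_left₀ (norm_nonneg a) ha 2
      rw [hκ]
      have h3 : 0 ≤ 1 - t ^ 2 := by nlinarith
      gcongr
    linarith
  -- Dividing out a zero raises the modulus everywhere on the disk, so the zero-free annulus is
  -- inherited by the quotient, and at `t` it raises it by a factor of at least `1 / q`. Since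
  -- moduli never exceed 1, fewer than `n` divisions are possible when `q ^ n < ‖ψ t‖`.
  have main : ∀ n : ℕ, ∀ ψ ∈ hInftyBall, BoundaryUnimodular ψ →
      (∀ z ∈ ball (0 : ℂ) 1, r₀ < ‖z‖ → 1 - 1 / 2 < ‖ψ z‖) → q ^ n < ‖ψ t‖ →
      IsFiniteBlaschke ψ := by
    intro n
    induction n with
    | zero =>
      intro ψ hψ _ _ hn
      have := hψ.2 t htb
      rw [pow_zero] at hn
      linarith
    | succ n ih =>
      intro ψ hψ hbψ h2 hn
      by_cases hz : ∀ z ∈ ball (0 : ℂ) 1, ψ z ≠ 0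
      · exact isFiniteBlaschke_of_forall_ne_zero hψ hbψ hz
      push Not at hz
      obtain ⟨a, ha, ha0⟩ := hz
      have ha1 : ‖a‖ < 1 := by simpa using ha
      have har : ‖a‖ ≤ t := by
        by_contra! hcon
        have := h2 a ha (by linarith)
        rw [ha0, norm_zero] at this
        norm_num at this
      obtain ⟨χ, hχ, hχf⟩ := exists_blaschkeFactor_mul hψ ha1 ha0
      have hle : ∀ z ∈ ball (0 : ℂ) 1, ‖ψ z‖ ≤ ‖χ z‖ := by
        intro z hz
        rw [hχf z hz, norm_mul]
        exact mul_le_of_le_one_left (norm_nonneg _)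
          (norm_blaschkeFactor_le_one ha1 (by simpa using (mem_ball.1 hz).le))
      refine (ih χ hχ (fun ε hε => ?_) (fun z hz hr => (h2 z hz hr).trans_le (hle z hz))
        ?_).blaschkeFactor_mul ha1 hχf
      · obtain ⟨r, hr, h⟩ := hbψ ε hε
        exact ⟨r, hr, fun z hz hrz => (h z hz hrz).trans_le (hle z hz)⟩
      · rw [hχf t htb, norm_mul, pow_succ'] at hn
        have h5 : q * q ^ n < q * ‖χ t‖ :=
          hn.trans_le (mul_le_mul_of_nonneg_right (hfac a har) (norm_nonneg _))
        exact lt_of_mul_lt_mul_left h5 hq0.le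
  have hpos : 1 - 1 / 2 < ‖φ t‖ := h₀ t htb (by rw [hnt]; exact hrt)
  obtain ⟨n, hn⟩ := exists_pow_lt_of_lt_one (by linarith : 0 < ‖φ t‖) hq1
  exact main n φ hφ hb h₀ hn

/-! ### Weighted area integrals in terms of Taylor coefficients -/

/-- The Taylor coefficients at the origin. -/
def taylorCoeff (g : ℂ → ℂ) (n : ℕ) : ℂ := (n.factorial : ℂ)⁻¹ * iteratedDeriv n g 0

/-- Parametrizing the circle turns a Fourier coefficient into a Cauchy integral: for `n ≥ 0` it
yields a Taylor coefficient, and for `n < 0` the integrand is analytic and the integral vanishes. -/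
theorem fourierCoeffOn_circleMap (g : ℂ → ℂ) {r : ℝ} (h0 : 0 < r) (n : ℤ) :
    fourierCoeffOn Real.two_pi_pos (fun θ => g (circleMap 0 r θ)) n =
      (2 * Real.pi * Complex.I)⁻¹ * (r : ℂ) ^ n * ∮ z in C(0, r), z ^ (-n - 1) * g z := by
  have hr : (r : ℂ) ≠ 0 := by exact_mod_cast h0.ne'
  rw [fourierCoeffOn_eq_integral, circleIntegral, ← intervalIntegral.integral_const_mul,
    ← intervalIntegral.integral_smul]
  refine intervalIntegral.integral_congr fun θ _ => ?_
  simp only [fourier_coe_apply, deriv_circleMap, circleMap_zero, smul_eq_mul, sub_zero]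
  have hpi : (Real.pi : ℂ) ≠ 0 := by exact_mod_cast Real.pi_ne_zero
  have e1 : 2 * (Real.pi : ℂ) * Complex.I * ((-n : ℤ) : ℂ) * θ / ((2 * Real.pi : ℝ) : ℂ) =
      ((-n : ℤ) : ℂ) * (θ * Complex.I) := by
    push_cast
    field_simp
  rw [e1, Complex.exp_int_mul, mul_zpow, Complex.real_smul]
  set E := Complex.exp (θ * Complex.I)
  have hE : E ≠ 0 := Complex.exp_ne_zero _
  rw [sub_eq_add_neg, zpow_add₀ hr, zpow_add₀ hE, zpow_neg, zpow_neg, zpow_neg_one, zpow_neg_one]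
  have hr' : (r : ℂ) ^ n ≠ 0 := zpow_ne_zero _ hr
  have hE' : E ^ n ≠ 0 := zpow_ne_zero _ hE
  push_cast
  field_simp

theorem fourierCoeffOn_circleMap_natCast {g : ℂ → ℂ} (hg : DifferentiableOn ℂ g (ball 0 1))
    {r : ℝ} (h0 : 0 < r) (h1 : r < 1) (n : ℕ) :
    fourierCoeffOn Real.two_pi_pos (fun θ => g (circleMap 0 r θ)) (n : ℤ) =
      taylorCoeff g n * r ^ n := by
  have hd : DiffContOnCl ℂ g (ball 0 r) := (hg.mono (by
    rw [closure_ball _ h0.ne']; exact closedBall_subset_ball h1)).diffContOnCl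
  have h := hd.circleIntegral_one_div_sub_center_pow_smul h0 n
  rw [fourierCoeffOn_circleMap g h0, taylorCoeff]
  have e : (∮ z in C(0, r), z ^ (-(n : ℤ) - 1) * g z) =
      ∮ z in C(0, r), (1 / (z - 0) ^ (n + 1)) • g z := by
    refine circleIntegral.integral_congr h0.le fun z _ => ?_
    rw [sub_zero, smul_eq_mul, one_div, show -(n : ℤ) - 1 = -((n + 1 : ℕ) : ℤ) by push_cast; ring,
      zpow_neg, zpow_natCast]
  rw [e, h, smul_eq_mul, zpow_natCast]
  have hpi : (Real.pi : ℂ) ≠ 0 := by exact_mod_cast Real.pi_ne_zero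
  field_simp

theorem fourierCoeffOn_circleMap_of_neg {g : ℂ → ℂ} (hg : DifferentiableOn ℂ g (ball 0 1))
    {r : ℝ} (h0 : 0 < r) (h1 : r < 1) {n : ℤ} (hn : n < 0) :
    fourierCoeffOn Real.two_pi_pos (fun θ => g (circleMap 0 r θ)) n = 0 := by
  obtain ⟨m, hm⟩ := Int.eq_ofNat_of_zero_le (show 0 ≤ -n - 1 by omega)
  rw [fourierCoeffOn_circleMap g h0, hm]
  have hd : DiffContOnCl ℂ (fun z => z ^ m * g z) (ball 0 r) := by
    refine DifferentiableOn.diffContOnCl ?_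
    rw [closure_ball _ h0.ne']
    exact (DifferentiableOn.mul (by fun_prop) hg).mono (closedBall_subset_ball h1)
  have := hd.circleIntegral_eq_zero h0.le
  simp only [zpow_natCast]
  rw [this, mul_zero]

/-- Parseval's identity on a circle. -/
theorem hasSum_norm_taylorCoeff_sq {g : ℂ → ℂ} (hg : DifferentiableOn ℂ g (ball 0 1)) {r : ℝ}
    (h0 : 0 < r) (h1 : r < 1) :
    HasSum (fun n : ℕ => ‖taylorCoeff g n‖ ^ 2 * r ^ (2 * n))
      ((2 * Real.pi)⁻¹ * ∫ θ in -Real.pi..Real.pi, ‖g (circleMap 0 r θ)‖ ^ 2) := by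
  have hc : Continuous fun θ => g (circleMap 0 r θ) :=
    hg.continuousOn.comp_continuous (continuous_circleMap 0 r) fun θ => by
      simpa [abs_of_pos h0] using h1
  have hm : MemLp (fun θ => g (circleMap 0 r θ)) 2 (volume.restrict (Ioc 0 (2 * Real.pi))) := by
    refine MemLp.mono_measure (Measure.restrict_mono Ioc_subset_Icc_self le_rfl) ?_
    obtain ⟨C, hC⟩ := isCompact_Icc.exists_bound_of_continuousOn
      (hc.continuousOn (s := Icc 0 (2 * Real.pi)))
    exact MemLp.of_bound hc.aestronglyMeasurable C (ae_restrict_of_forall_mem measurableSet_Icc hC)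
  have h := hasSum_sq_fourierCoeffOn Real.two_pi_pos hm
  rw [← (Nat.cast_injective (R := ℤ)).hasSum_iff] at h
  · convert h using 1
    · funext n
      simp only [Function.comp, fourierCoeffOn_circleMap_natCast hg h0 h1, norm_mul, norm_pow,
        Complex.norm_real, Real.norm_eq_abs, abs_of_pos h0]
      ring
    · rw [sub_zero, smul_eq_mul]
      congr 1
      -- The Fourier basis lives on `[0, 2π]`, while polar coordinates use `(-π, π)`; periodicity
      -- moves the integral.
      have hp : Function.Periodic (fun θ => ‖g (circleMap 0 r θ)‖ ^ 2) (2 * Real.pi) := fun θ => by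
        simp only [periodic_circleMap 0 r θ]
      have := hp.intervalIntegral_add_eq (-Real.pi) 0
      rw [zero_add, show -Real.pi + 2 * Real.pi = Real.pi by ring] at this
      exact this
  · intro n hn
    have hn' : n < 0 := by
      by_contra! hcon
      exact hn ⟨n.toNat, by simp [hcon]⟩
    rw [fourierCoeffOn_circleMap_of_neg hg h0 h1 hn']
    simp

theorem lintegral_circle_eq_tsum {g : ℂ → ℂ} (hg : DifferentiableOn ℂ g (ball 0 1)) {r : ℝ}
    (h0 : 0 < r) (h1 : r < 1) :
    ∫⁻ θ in Ioo (-Real.pi) Real.pi, ‖g (circleMap 0 r θ)‖ₑ ^ 2 =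
      ENNReal.ofReal (2 * Real.pi) *
        ∑' n, ‖taylorCoeff g n‖ₑ ^ 2 * ENNReal.ofReal (r ^ (2 * n)) := by
  have hc : Continuous fun θ => g (circleMap 0 r θ) :=
    hg.continuousOn.comp_continuous (continuous_circleMap 0 r) fun θ => by
      simpa [abs_of_pos h0] using h1
  have h := hasSum_norm_taylorCoeff_sq hg h0 h1
  have hpi := Real.pi_pos
  have e : ∀ n, ‖taylorCoeff g n‖ₑ ^ 2 * ENNReal.ofReal (r ^ (2 * n)) =
      ENNReal.ofReal (‖taylorCoeff g n‖ ^ 2 * r ^ (2 * n)) := fun n => by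
    rw [ENNReal.ofReal_mul (by positivity), ENNReal.ofReal_pow (norm_nonneg _), ofReal_norm]
  simp only [e]
  rw [← ENNReal.ofReal_tsum_of_nonneg (fun n => by positivity) h.summable, h.tsum_eq,
    ← ENNReal.ofReal_mul (by positivity), mul_inv_cancel_left₀ (by positivity),
    intervalIntegral.integral_of_le (by linarith), integral_Ioc_eq_integral_Ioo,
    ofReal_integral_eq_lintegral_ofReal]
  · refine lintegral_congr fun θ => ?_
    rw [ENNReal.ofReal_pow (norm_nonneg _), ofReal_norm]
  · exact ((hc.norm.pow 2).integrableOn_Icc).mono_set Ioo_subset_Icc_self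
  · exact ae_of_all _ fun θ => by positivity

/-- Integration over the unit disk in polar coordinates. -/
theorem lintegral_ball_eq_polar {F : ℂ → ℝ≥0∞} (hF : Measurable F) :
    ∫⁻ z in ball 0 1, F z = ∫⁻ r in Ioo (0 : ℝ) 1, ENNReal.ofReal r *
      ∫⁻ θ in Ioo (-Real.pi) Real.pi, F (circleMap 0 r θ) := by
  have hs : Measurable Complex.polarCoord.symm := by
    have : (Complex.polarCoord.symm : ℝ × ℝ → ℂ) =
        fun p : ℝ × ℝ => (p.1 : ℂ) * (Real.cos p.2 + Real.sin p.2 * Complex.I) :=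
      funext Complex.polarCoord_symm_apply
    rw [this]
    fun_prop
  have hG : Measurable ((ball (0 : ℂ) 1).indicator F) := hF.indicator measurableSet_ball
  have e : ∀ r θ, Complex.polarCoord.symm (r, θ) = circleMap 0 r θ := fun r θ => by
    rw [Complex.polarCoord_symm_apply, circleMap_zero, Complex.exp_mul_I]
    simp
  rw [← lintegral_indicator measurableSet_ball, ← Complex.lintegral_comp_polarCoord_symm,
    polarCoord_target, Measure.volume_eq_prod, setLIntegral_prod]
  · have h : ∀ r ∈ Ioi (0 : ℝ), (∫⁻ θ in Ioo (-Real.pi) Real.pi,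
        ENNReal.ofReal r • (ball (0 : ℂ) 1).indicator F (Complex.polarCoord.symm (r, θ))) =
        (Iio 1).indicator (fun r => ENNReal.ofReal r *
          ∫⁻ θ in Ioo (-Real.pi) Real.pi, F (circleMap 0 r θ)) r := by
      intro r hr
      simp only [smul_eq_mul, e]
      rw [lintegral_const_mul' _ _ ENNReal.ofReal_ne_top]
      by_cases hr1 : r < 1
      · rw [indicator_of_mem (s := Iio (1 : ℝ)) hr1]
        congr 1
        refine setLIntegral_congr_fun measurableSet_Ioo fun θ _ => ?_
        rw [indicator_of_mem]
        simpa [abs_of_pos (mem_Ioi.1 hr)] using hr1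
      · rw [indicator_of_notMem (s := Iio (1 : ℝ)) hr1]
        refine (congrArg _ (lintegral_congr (g := fun _ => 0) fun θ => ?_)).trans (by simp)
        rw [indicator_of_notMem]
        simpa [abs_of_pos (mem_Ioi.1 hr)] using hr1
    rw [setLIntegral_congr_fun measurableSet_Ioi h, lintegral_indicator measurableSet_Iio,
      Measure.restrict_restrict measurableSet_Iio, inter_comm, Ioi_inter_Iio]
  · exact ((ENNReal.measurable_ofReal.comp measurable_fst).smul (hG.comp hs)).aemeasurable

/-- Restates that the beta density has total mass one. -/
theorem lintegral_rpow_mul_one_sub_rpow {a b : ℝ} (ha : 0 < a) (hb : 0 < b) :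
    ∫⁻ x in Ioo (0 : ℝ) 1, ENNReal.ofReal (x ^ (a - 1) * (1 - x) ^ (b - 1)) =
      ENNReal.ofReal (ProbabilityTheory.beta a b) := by
  have h := ProbabilityTheory.lintegral_betaPDF_eq_one ha hb
  have hB := ProbabilityTheory.beta_pos ha hb
  rw [ProbabilityTheory.lintegral_betaPDF] at h
  have e : ∀ x : ℝ, ENNReal.ofReal (1 / ProbabilityTheory.beta a b * x ^ (a - 1) *
      (1 - x) ^ (b - 1)) = ENNReal.ofReal (1 / ProbabilityTheory.beta a b) *
        ENNReal.ofReal (x ^ (a - 1) * (1 - x) ^ (b - 1)) := fun x => by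
    rw [mul_assoc, ENNReal.ofReal_mul (by positivity)]
  simp only [e] at h
  rw [lintegral_const_mul' _ _ ENNReal.ofReal_ne_top, one_div, ENNReal.ofReal_inv_of_pos hB] at h
  rw [← inv_inv (ENNReal.ofReal (ProbabilityTheory.beta a b))]
  exact ENNReal.eq_inv_of_mul_eq_one_left (by rwa [mul_comm])

/-- The substitution `x = r²`, with `dx = 2 r dr`, turns this into a Beta integral. -/
theorem lintegral_radial {γ : ℝ} (hγ : -1 < γ) (n : ℕ) :
    ∫⁻ r in Ioo (0 : ℝ) 1, ENNReal.ofReal (2 * r * (r ^ (2 * n) * (1 - r ^ 2) ^ γ)) =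
      ENNReal.ofReal (ProbabilityTheory.beta (n + 1) (γ + 1)) := by
  rw [← lintegral_rpow_mul_one_sub_rpow (by positivity) (by linarith)]
  have him : (fun r : ℝ => r ^ 2) '' Ioo 0 1 = Ioo 0 1 := by
    ext x
    constructor
    · rintro ⟨r, ⟨h0, h1⟩, rfl⟩
      exact ⟨by positivity, by nlinarith⟩
    · rintro ⟨h0, h1⟩
      exact ⟨√x, ⟨Real.sqrt_pos.2 h0, by rw [Real.sqrt_lt' one_pos]; linarith⟩,
        Real.sq_sqrt h0.le⟩
  have hinj : InjOn (fun r : ℝ => r ^ 2) (Ioo 0 1) := fun x hx y hy h =>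
    (pow_left_inj₀ hx.1.le hy.1.le two_ne_zero).1 h
  conv_rhs => rw [← him]
  rw [lintegral_image_eq_lintegral_abs_deriv_mul measurableSet_Ioo
    (f' := fun r => 2 * r) (fun r _ => by simpa using (hasDerivAt_pow 2 r).hasDerivWithinAt) hinj]
  refine setLIntegral_congr_fun measurableSet_Ioo fun r hr => ?_
  have hr0 : 0 < r := hr.1
  rw [abs_of_pos (by linarith), ← ENNReal.ofReal_mul (by linarith), add_sub_cancel_right,
    add_sub_cancel_right, Real.rpow_natCast, ← pow_mul]

/-- The area integral of `|g|² (1 - |z|²)^γ` over the unit disk in terms of the Taylor coefficients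
of `g`. -/
theorem lintegral_norm_sq_mul_rpow {g : ℂ → ℂ} (hg : DifferentiableOn ℂ g (ball 0 1)) {γ : ℝ}
    (hγ : -1 < γ) :
    ∫⁻ z in ball 0 1, ‖g z‖ₑ ^ 2 * ENNReal.ofReal ((1 - ‖z‖ ^ 2) ^ γ) =
      ∑' n : ℕ, ‖taylorCoeff g n‖ₑ ^ 2 *
        ENNReal.ofReal (Real.pi * ProbabilityTheory.beta (n + 1) (γ + 1)) := by
  set F : ℂ → ℝ≥0∞ := (ball 0 1).indicator fun w => ‖g w‖ₑ ^ 2 with hF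
  have hFm : Measurable F := by
    classical
    rw [hF, ← Set.piecewise_eq_indicator]
    exact ((ENNReal.continuous_pow 2).comp_continuousOn
      hg.continuousOn.enorm).measurable_piecewise continuousOn_const measurableSet_ball
  have h1 : ∫⁻ z in ball 0 1, ‖g z‖ₑ ^ 2 * ENNReal.ofReal ((1 - ‖z‖ ^ 2) ^ γ) =
      ∫⁻ z in ball 0 1, F z * ENNReal.ofReal ((1 - ‖z‖ ^ 2) ^ γ) :=
    setLIntegral_congr_fun measurableSet_ball fun z hz => by simp only [hF, indicator_of_mem hz]
  rw [h1, lintegral_ball_eq_polar (F := fun z => F z * ENNReal.ofReal ((1 - ‖z‖ ^ 2) ^ γ))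
    (hFm.mul (by fun_prop))]
  have hpi := Real.pi_pos
  have h2 : ∀ r ∈ Ioo (0 : ℝ) 1, (ENNReal.ofReal r * ∫⁻ θ in Ioo (-Real.pi) Real.pi,
      F (circleMap 0 r θ) * ENNReal.ofReal ((1 - ‖circleMap 0 r θ‖ ^ 2) ^ γ)) =
      ∑' n : ℕ, ‖taylorCoeff g n‖ₑ ^ 2 * (ENNReal.ofReal Real.pi *
        ENNReal.ofReal (2 * r * (r ^ (2 * n) * (1 - r ^ 2) ^ γ))) := by
    intro r hr
    have hr0 : 0 < r := hr.1
    have hpos : 0 ≤ (1 - r ^ 2) ^ γ := Real.rpow_nonneg (by nlinarith [hr.2]) _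
    have e1 : ∀ θ, F (circleMap 0 r θ) * ENNReal.ofReal ((1 - ‖circleMap 0 r θ‖ ^ 2) ^ γ) =
        ‖g (circleMap 0 r θ)‖ₑ ^ 2 * ENNReal.ofReal ((1 - r ^ 2) ^ γ) := by
      intro θ
      have : circleMap 0 r θ ∈ ball (0 : ℂ) 1 := by simpa [abs_of_pos hr0] using hr.2
      rw [hF, indicator_of_mem this]
      simp
    simp only [e1]
    rw [lintegral_mul_const' _ _ ENNReal.ofReal_ne_top, lintegral_circle_eq_tsum hg hr0 hr.2,
      ← ENNReal.tsum_mul_left, ← ENNReal.tsum_mul_right, ← ENNReal.tsum_mul_left]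
    refine tsum_congr fun n => ?_
    rw [show ENNReal.ofReal r * (ENNReal.ofReal (2 * Real.pi) *
      (‖taylorCoeff g n‖ₑ ^ 2 * ENNReal.ofReal (r ^ (2 * n))) * ENNReal.ofReal ((1 - r ^ 2) ^ γ)) =
      ‖taylorCoeff g n‖ₑ ^ 2 * (ENNReal.ofReal r * ENNReal.ofReal (2 * Real.pi) *
      ENNReal.ofReal (r ^ (2 * n)) * ENNReal.ofReal ((1 - r ^ 2) ^ γ)) by ring]
    rw [← ENNReal.ofReal_mul (by positivity), ← ENNReal.ofReal_mul (by positivity),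
      ← ENNReal.ofReal_mul (by positivity), ← ENNReal.ofReal_mul (by positivity)]
    congr 2
    ring
  rw [setLIntegral_congr_fun measurableSet_Ioo h2, lintegral_tsum fun n => by fun_prop]
  refine tsum_congr fun n => ?_
  rw [lintegral_const_mul' _ _ (by finiteness), lintegral_const_mul' _ _ ENNReal.ofReal_ne_top,
    lintegral_radial hγ, ENNReal.ofReal_mul hpi.le]

/-! ### The spaces `A²_γ` in terms of Taylor coefficients -/

theorem beta_add_one_right {a b : ℝ} (ha : 0 < a) (hb : 0 < b) :
    ProbabilityTheory.beta a (b + 1) = b / (a + b) * ProbabilityTheory.beta a b := by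
  have h := (Real.Gamma_pos_of_pos (add_pos ha hb)).ne'
  rw [ProbabilityTheory.beta, ProbabilityTheory.beta, Real.Gamma_add_one hb.ne', ← add_assoc,
    Real.Gamma_add_one (add_pos ha hb).ne']
  field_simp

theorem beta_add_one_left {a b : ℝ} (ha : 0 < a) (hb : 0 < b) :
    ProbabilityTheory.beta (a + 1) b = a / (a + b) * ProbabilityTheory.beta a b := by
  have h := (Real.Gamma_pos_of_pos (add_pos ha hb)).ne'
  rw [ProbabilityTheory.beta, ProbabilityTheory.beta, Real.Gamma_add_one ha.ne', add_right_comm,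
    Real.Gamma_add_one (add_pos ha hb).ne']
  field_simp

theorem differentiableOn_iteratedDeriv {g : ℂ → ℂ} (hg : DifferentiableOn ℂ g (ball 0 1)) (k : ℕ) :
    DifferentiableOn ℂ (iteratedDeriv k g) (ball 0 1) := by
  induction k with
  | zero => simpa using hg
  | succ k ih =>
    rw [iteratedDeriv_succ]
    exact ih.deriv isOpen_ball

theorem taylorCoeff_iteratedDeriv (g : ℂ → ℂ) (k n : ℕ) :
    taylorCoeff (iteratedDeriv k g) n = (n + k).descFactorial k * taylorCoeff g (n + k) := by
  have h : (n.factorial : ℂ) * (n + k).descFactorial k = (n + k).factorial := by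
    have := Nat.factorial_mul_descFactorial (Nat.le_add_left k n)
    rw [Nat.add_sub_cancel] at this
    exact_mod_cast this
  have h1 : ((n + k).factorial : ℂ) ≠ 0 := by exact_mod_cast (n + k).factorial_ne_zero
  have h2 : (n.factorial : ℂ) ≠ 0 := by exact_mod_cast n.factorial_ne_zero
  have h3 : iteratedDeriv n (iteratedDeriv k g) = iteratedDeriv (n + k) g := by
    simp only [iteratedDeriv_eq_iterate, Function.iterate_add_apply]
  rw [taylorCoeff, taylorCoeff, h3, ← h]
  rw [← h] at h1
  field_simp

theorem enorm_sq_mul_ofReal (a : ℂ) (w : ℝ) :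
    ‖a‖ₑ ^ 2 * ENNReal.ofReal w = ENNReal.ofReal (‖a‖ ^ 2 * w) := by
  rw [ENNReal.ofReal_mul (by positivity), ENNReal.ofReal_pow (norm_nonneg _), ofReal_norm]

theorem tsum_ofReal_lt_top_iff {f : ℕ → ℝ} (hf : ∀ n, 0 ≤ f n) :
    ∑' n, ENNReal.ofReal (f n) < ⊤ ↔ Summable f := by
  refine ⟨fun h => ?_, fun h => ?_⟩
  · have := ENNReal.summable_toReal h.ne
    simpa only [ENNReal.toReal_ofReal (hf _)] using this
  · rw [← ENNReal.ofReal_tsum_of_nonneg hf h]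
    exact ENNReal.ofReal_lt_top

/-- The weight of the `m`-th Taylor coefficient in the norm of `A²_γ` given by the `k`-th
derivative, up to a constant factor. -/
def derivWeight (γ : ℝ) (k m : ℕ) : ℝ :=
  (m.descFactorial k : ℝ) ^ 2 * ProbabilityTheory.beta ((m - k : ℕ) + 1) (γ + 2 * k + 1)

theorem mem_genBergman_iff_summable {γ : ℝ} {k : ℕ} (hk : -1 < 2 * (k : ℝ) + γ) {g : ℂ → ℂ}
    (hg : DifferentiableOn ℂ g (ball 0 1)) :
    g ∈ genBergman γ k ↔ Summable fun m => ‖taylorCoeff g m‖ ^ 2 * derivWeight γ k m := by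
  have hpi := Real.pi_pos
  have hgk := differentiableOn_iteratedDeriv hg k
  have hint : IntegrableOn (fun z => (1 - ‖z‖ ^ 2) ^ (2 * k) * ‖iteratedDeriv k g z‖ ^ 2 *
      (1 - ‖z‖ ^ 2) ^ γ) (ball 0 1) ↔ ∫⁻ z in ball 0 1, ‖iteratedDeriv k g z‖ₑ ^ 2 *
        ENNReal.ofReal ((1 - ‖z‖ ^ 2) ^ (γ + 2 * k)) < ⊤ := by
    have e : ∫⁻ z in ball 0 1, ‖iteratedDeriv k g z‖ₑ ^ 2 *
        ENNReal.ofReal ((1 - ‖z‖ ^ 2) ^ (γ + 2 * k)) = ∫⁻ z in ball 0 1,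
        ‖(1 - ‖z‖ ^ 2) ^ (2 * k) * ‖iteratedDeriv k g z‖ ^ 2 * (1 - ‖z‖ ^ 2) ^ γ‖ₑ := by
      refine setLIntegral_congr_fun measurableSet_ball fun z hz => ?_
      have h1 : ‖z‖ < 1 := by simpa using hz
      have h2 : 0 < 1 - ‖z‖ ^ 2 := by nlinarith [norm_nonneg z]
      have h3 := Real.rpow_pos_of_pos h2 γ
      rw [enorm_sq_mul_ofReal, Real.enorm_eq_ofReal (by positivity), Real.rpow_add h2,
        show 2 * (k : ℝ) = ((2 * k : ℕ) : ℝ) by push_cast; rfl, Real.rpow_natCast]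
      congr 1
      ring
    rw [e, IntegrableOn, Integrable, HasFiniteIntegral, and_iff_right]
    refine AEStronglyMeasurable.mul (AEStronglyMeasurable.mul (by fun_prop) ?_)
      (Measurable.aestronglyMeasurable (by fun_prop))
    exact ((hgk.continuousOn.norm).pow 2).aestronglyMeasurable measurableSet_ball
  rw [genBergman, mem_ofPred_eq, and_iff_right hg, hint,
    lintegral_norm_sq_mul_rpow hgk (by linarith)]
  simp only [enorm_sq_mul_ofReal]
  have hB : ∀ n : ℕ, 0 < ProbabilityTheory.beta ((n : ℝ) + 1) (γ + 2 * k + 1) := fun n =>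
    ProbabilityTheory.beta_pos (by positivity) (by linarith)
  -- The sum for the `k`-th derivative is indexed from its own zeroth coefficient, so the first `k`
  -- terms are dropped. In the remaining range the subtraction `m - k` in `derivWeight` is exact.
  rw [tsum_ofReal_lt_top_iff fun n => by have := hB n; positivity, ← summable_nat_add_iff (f := fun m => ‖taylorCoeff g m‖ ^ 2 * derivWeight γ k m) k,
    ← summable_mul_left_iff (f := fun n => ‖taylorCoeff g (n + k)‖ ^ 2 * derivWeight γ k (n + k))
      hpi.ne']
  refine summable_congr fun n => ?_
  rw [taylorCoeff_iteratedDeriv, norm_mul, Complex.norm_natCast, derivWeight, Nat.add_sub_cancel]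
  ring

theorem summable_mul_iff_of_comparable {a u v : ℕ → ℝ} {N : ℕ} {c C : ℝ} (ha : ∀ n, 0 ≤ a n)
    (hu : ∀ n, N ≤ n → 0 ≤ u n) (hc : 0 < c) (h1 : ∀ n, N ≤ n → c * u n ≤ v n)
    (h2 : ∀ n, N ≤ n → v n ≤ C * u n) :
    (Summable fun n => a n * u n) ↔ Summable fun n => a n * v n := by
  rw [← summable_nat_add_iff N, ← summable_nat_add_iff (f := fun n => a n * v n) N]
  refine ⟨fun h => ?_, fun h => ?_⟩
  · refine Summable.of_nonneg_of_le (fun n => ?_) (fun n => ?_) (h.mul_left C)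
    · exact mul_nonneg (ha _) ((mul_nonneg hc.le (hu _ (by omega))).trans (h1 _ (by omega)))
    · calc _ ≤ a (n + N) * (C * u (n + N)) :=
            mul_le_mul_of_nonneg_left (h2 _ (by omega)) (ha _)
        _ = _ := by ring
  · refine Summable.of_nonneg_of_le (fun n => mul_nonneg (ha _) (hu _ (by omega))) (fun n => ?_)
      (h.mul_left c⁻¹)
    rw [le_inv_mul_iff₀ hc]
    calc _ = a (n + N) * (c * u (n + N)) := by ring
      _ ≤ _ := mul_le_mul_of_nonneg_left (h1 _ (by omega)) (ha _)

/-- One more derivative contributes `(m - k)²`, while the Beta factor loses two powers of `m`; the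
ratio of weights therefore stays between positive constants. The index starts at `k + 1` because at
`m = k` the new weight vanishes and the old one does not. This ratio is why `A²_γ` does not depend
on `k`. -/
theorem derivWeight_succ {γ : ℝ} {k : ℕ} (hk : -1 < 2 * (k : ℝ) + γ) (j : ℕ) :
    derivWeight γ (k + 1) (j + (k + 1)) = (γ + 2 * k + 1) * (γ + 2 * k + 2) *
      ((j + 1) / (j + 1 + (γ + 2 * k + 2))) * derivWeight γ k (j + (k + 1)) := by
  have hb : 0 < γ + 2 * (k : ℝ) + 1 := by linarith
  have hj : (0 : ℝ) < j + 1 := by positivity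
  rw [derivWeight, derivWeight, Nat.descFactorial_succ, Nat.add_sub_cancel,
    show j + (k + 1) - k = j + 1 by omega]
  push_cast
  set b := γ + 2 * (k : ℝ) + 1 with hbdef
  rw [show γ + 2 * ((k : ℝ) + 1) + 1 = b + 1 + 1 by rw [hbdef]; ring,
    beta_add_one_right hj (by linarith), beta_add_one_right hj hb, beta_add_one_left hj hb,
    show γ + 2 * (k : ℝ) + 2 = b + 1 by rw [hbdef]; ring]
  field_simp

theorem derivWeight_nonneg {γ : ℝ} {k : ℕ} (hk : -1 < 2 * (k : ℝ) + γ) (m : ℕ) :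
    0 ≤ derivWeight γ k m :=
  mul_nonneg (sq_nonneg _) (ProbabilityTheory.beta_pos (by positivity) (by linarith)).le

theorem summable_derivWeight_succ_iff {γ : ℝ} {k : ℕ} (hk : -1 < 2 * (k : ℝ) + γ) {a : ℕ → ℝ}
    (ha : ∀ n, 0 ≤ a n) : (Summable fun m => a m * derivWeight γ k m) ↔
      Summable fun m => a m * derivWeight γ (k + 1) m := by
  have hb : 0 < γ + 2 * (k : ℝ) + 1 := by linarith
  have hc : 0 < (γ + 2 * (k : ℝ) + 1) * (γ + 2 * k + 2) := mul_pos hb (by linarith)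
  have hs : 0 < γ + 2 * (k : ℝ) + 2 := by linarith
  have hs1 : 0 < 1 + (γ + 2 * (k : ℝ) + 2) := by linarith
  refine summable_mul_iff_of_comparable (N := k + 1)
    (c := (γ + 2 * k + 1) * (γ + 2 * k + 2) * (1 / (1 + (γ + 2 * k + 2))))
    (C := (γ + 2 * k + 1) * (γ + 2 * k + 2) * 1) ha (fun n _ => derivWeight_nonneg hk n)
    (by positivity) ?_ ?_
  all_goals
    intro n hn
    obtain ⟨j, rfl⟩ := Nat.exists_eq_add_of_le' hn
    have hw := derivWeight_nonneg hk (j + (k + 1))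
    rw [derivWeight_succ hk]
    refine mul_le_mul_of_nonneg_right (mul_le_mul_of_nonneg_left ?_ hc.le) hw
  · rw [div_le_div_iff₀ hs1 (by positivity)]
    nlinarith [mul_nonneg (Nat.cast_nonneg (α := ℝ) j) hs.le]
  · exact div_le_one_of_le₀ (by linarith) (by positivity)

/-- The choice `k = 1` is admissible for every `α > -1`. Its weight is `n (α + 1)` times the Beta
factor, comparable for `n ≥ 1` to the weight stated here; all other admissible `k` reduce to this
one. -/
theorem mem_genBergman_sub_one_iff {α : ℝ} (hα : -1 < α) {k : ℕ}
    (hk : -1 < 2 * (k : ℝ) + (α - 1)) {g : ℂ → ℂ} (hg : DifferentiableOn ℂ g (ball 0 1)) :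
    g ∈ genBergman (α - 1) k ↔ Summable fun n : ℕ => ‖taylorCoeff g n‖ ^ 2 *
      ((n + α + 2) * ProbabilityTheory.beta (n + 1) (α + 1)) := by
  rw [mem_genBergman_iff_summable hk hg]
  have ha : ∀ n, 0 ≤ ‖taylorCoeff g n‖ ^ 2 := fun n => by positivity
  have one : (Summable fun m => ‖taylorCoeff g m‖ ^ 2 * derivWeight (α - 1) 1 m) ↔
      Summable fun n : ℕ => ‖taylorCoeff g n‖ ^ 2 *
        ((n + α + 2) * ProbabilityTheory.beta (n + 1) (α + 1)) := by
    refine (summable_mul_iff_of_comparable (N := 1) (c := (α + 1) / (α + 3)) (C := α + 1) ?_ ?_ ?_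
      ?_ ?_).symm
    · intro n; positivity
    · intro n _
      have := ProbabilityTheory.beta_pos (α := (n : ℝ) + 1) (β := α + 1) (by positivity)
        (by linarith)
      have : 0 < (n : ℝ) + α + 2 := by have := Nat.cast_nonneg (α := ℝ) n; linarith
      positivity
    · exact div_pos (by linarith) (by linarith)
    all_goals
      intro n hn
      obtain ⟨j, rfl⟩ := Nat.exists_eq_add_of_le' hn
      have hj : (0 : ℝ) < j + 1 := by positivity
      have hB := ProbabilityTheory.beta_pos (α := (j : ℝ) + 1) (β := α + 1) hj (by linarith)
      have hs : 0 < (j : ℝ) + 1 + (α + 1) := by linarith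
      have e : derivWeight (α - 1) 1 (j + 1) = (j + 1) * (α + 1) *
          ProbabilityTheory.beta ((j + 1 : ℕ) + 1) (α + 1) := by
        rw [derivWeight, Nat.descFactorial_one, Nat.add_sub_cancel]
        push_cast
        rw [show α - 1 + 2 * 1 + 1 = α + 1 + 1 by ring, beta_add_one_right hj (by linarith),
          beta_add_one_left hj (by linarith)]
        field_simp
      have hB' := ProbabilityTheory.beta_pos (α := ((j + 1 : ℕ) : ℝ) + 1) (β := α + 1)
        (by positivity) (by linarith)
      rw [e, ← mul_assoc]
      refine mul_le_mul_of_nonneg_right ?_ hB'.le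
      push_cast
    · rw [div_mul_eq_mul_div, div_le_iff₀ (by linarith)]
      have h1 : 0 < α + 1 := by linarith
      have h2 : (j : ℝ) + 1 + α + 2 ≤ (j + 1) * (α + 3) := by
        nlinarith [Nat.cast_nonneg (α := ℝ) j, mul_nonneg (Nat.cast_nonneg (α := ℝ) j) h1.le]
      nlinarith
    · nlinarith [Nat.cast_nonneg (α := ℝ) j]
  rcases Nat.eq_zero_or_pos k with rfl | hk1
  · rw [summable_derivWeight_succ_iff hk fun n => by positivity]
    exact one
  · induction k, hk1 using Nat.le_induction with
    | base => exact one
    | succ m hm ih =>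
      have hm1 : (1 : ℝ) ≤ m := by exact_mod_cast hm
      have hm' : -1 < 2 * (m : ℝ) + (α - 1) := by linarith
      rw [← summable_derivWeight_succ_iff hm' fun n => by positivity]
      exact ih hm'

/-! ### Defect operators, ranges and compactness on a Hilbert space -/

section Hilbert

variable {H : Type*} [NormedAddCommGroup H] [InnerProductSpace ℂ H] [CompleteSpace H]

theorem isSelfAdjoint_defectOp (T : H →L[ℂ] H) : IsSelfAdjoint (defectOp T) :=
  (CFC.sqrt_nonneg _).isSelfAdjoint

theorem inner_defectOp_left (T : H →L[ℂ] H) (f g : H) :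
    inner ℂ (defectOp T f) g = inner ℂ f (defectOp T g) := by
  have h := (isSelfAdjoint_defectOp T).adjoint_eq
  conv_lhs => rw [← h]
  exact ContinuousLinearMap.adjoint_inner_left _ _ _

theorem inner_one_sub_adjoint_mul_self (T : H →L[ℂ] H) (f : H) :
    inner ℂ ((1 - T.adjoint * T) f) f = ((‖f‖ ^ 2 - ‖T f‖ ^ 2 : ℝ) : ℂ) := by
  have h : (1 - T.adjoint * T) f = f - T.adjoint (T f) := rfl
  rw [h, inner_sub_left, ContinuousLinearMap.adjoint_inner_left, inner_self_eq_norm_sq_to_K,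
    inner_self_eq_norm_sq_to_K]
  push_cast
  rfl

/-- `D` is self-adjoint with `D² = 1 - T* T`, so `‖D f‖² = ⟪D² f, f⟫`. Contractivity gives the
positivity needed for the square root to square back. -/
theorem norm_defectOp_sq {T : H →L[ℂ] H} (hT : ∀ f, ‖T f‖ ≤ ‖f‖) (f : H) :
    ‖defectOp T f‖ ^ 2 = ‖f‖ ^ 2 - ‖T f‖ ^ 2 := by
  have hpos : 0 ≤ 1 - T.adjoint * T := by
    rw [ContinuousLinearMap.nonneg_iff_isPositive, ContinuousLinearMap.isPositive_iff_complex]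
    intro x
    rw [inner_one_sub_adjoint_mul_self]
    have := hT x
    rw [RCLike.re_to_complex, Complex.ofReal_re]
    exact ⟨rfl, by nlinarith [norm_nonneg (T x)]⟩
  have h1 : defectOp T (defectOp T f) = (1 - T.adjoint * T) f := by
    change (CFC.sqrt (1 - T.adjoint * T) * CFC.sqrt (1 - T.adjoint * T)) f = _
    rw [CFC.sqrt_mul_sqrt_self _ hpos]
  have h2 := inner_one_sub_adjoint_mul_self T f
  rw [← h1, inner_defectOp_left, inner_self_eq_norm_sq_to_K] at h2
  exact Complex.ofReal_injective ((Complex.ofReal_pow _ 2).trans h2)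

/-- The range of an operator `D` for which `⟪D f, g⟫ = ⟪f, D g⟫`, in terms of the norms `‖D f‖`. -/
theorem mem_range_iff_exists_bound {D : H →L[ℂ] H}
    (hD : ∀ f g, inner ℂ (D f) g = inner ℂ f (D g)) (g : H) :
    (∃ h, D h = g) ↔ ∃ C : ℝ, ∀ f, ‖inner ℂ g f‖ ≤ C * ‖D f‖ := by
  refine ⟨?_, ?_⟩
  · rintro ⟨h, rfl⟩
    exact ⟨‖h‖, fun f => by rw [hD]; exact norm_inner_le_norm h (D f)⟩
  · rintro ⟨C, hC⟩
    have hwd : ∀ x y, D x = D y → inner ℂ g x = inner ℂ g y := by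
      intro x y hxy
      have := hC (x - y)
      rw [map_sub, hxy, sub_self, norm_zero, mul_zero, norm_le_zero_iff, inner_sub_right,
        sub_eq_zero] at this
      exact this
    choose s hs using fun y : D.range => y.2
    have hs' : ∀ y, D (s y) = y := hs
    -- The functional `D f ↦ ⟪g, f⟫` on the range is well defined and bounded by the hypothesis.
    -- Hahn–Banach extends it, and the Riesz vector `h` of the extension satisfies `⟪h, D f⟫ = ⟪g,
    -- f⟫`, that is, `D h = g`.
    let ℓ : D.range →ₗ[ℂ] ℂ :=
      { toFun := fun y => inner ℂ g (s y)
        map_add' := fun y z => by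
          rw [← inner_add_right]
          exact hwd _ _ (by rw [map_add, hs', hs', hs', Submodule.coe_add])
        map_smul' := fun c y => by
          rw [RingHom.id_apply, smul_eq_mul, ← inner_smul_right]
          exact hwd _ _ (by rw [map_smul, hs', hs', Submodule.coe_smul]) }
    obtain ⟨L, hL, -⟩ := exists_extension_norm_eq D.range (ℓ.mkContinuous C fun y => by
      have := hC (s y)
      rwa [hs'] at this)
    refine ⟨(InnerProductSpace.toDual ℂ H).symm L, ?_⟩
    refine ext_inner_right ℂ fun f => ?_
    rw [hD, InnerProductSpace.toDual_symm_apply]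
    have h1 := hL ⟨D f, f, rfl⟩
    rw [h1]
    exact hwd _ _ (hs' _)

/-- An operator whose range lies in that of an injective compact operator is compact. -/
theorem isCompactOperator_of_range_subset {D S : H →L[ℂ] H} (hS : IsCompactOperator S)
    (hinj : Function.Injective S) (h : ∀ f, ∃ x, S x = D f) : IsCompactOperator D := by
  choose x hx using h
  let X : H →ₗ[ℂ] H :=
    { toFun := x
      map_add' := fun f g => hinj (by rw [map_add, hx, hx, hx, map_add])
      map_smul' := fun c f => hinj (by rw [map_smul, hx, hx, map_smul, RingHom.id_apply]) }
  -- Closed graph theorem: if `u n → f` and `X (u n) → y`, then `S y = D f = S (X f)`, and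
  -- injectivity gives `y = X f`.
  have hX : Continuous X := X.continuous_of_seq_closed_graph fun u f y hu hy => hinj (by
    refine tendsto_nhds_unique ((S.continuous.tendsto y).comp hy) ?_
    have : (S ∘ X ∘ u) = fun n => D (u n) := funext fun n => hx _
    rw [this, show S (X f) = D f from hx f]
    exact (D.continuous.tendsto f).comp hu)
  have := hS.comp_clm (⟨X, hX⟩ : H →L[ℂ] H)
  exact (funext hx : (S ∘ x) = D) ▸ this

theorem isCompactOperator_smulRight {E : Type*} [NormedAddCommGroup E] [NormedSpace ℂ E]
    (l : E →L[ℂ] ℂ) (e : E) : IsCompactOperator (l.smulRight e) := by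
  have h : IsCompactOperator l := isCompactOperator_of_locallyCompactSpace_dom l
  exact h.clm_comp (ContinuousLinearMap.toSpanSingleton ℂ e)

end Hilbert

/-! ### Taylor coefficients of elements of `A²_α` -/

theorem lintegral_bergmanMeasure {α : ℝ} (F : ℂ → ℝ≥0∞) :
    ∫⁻ z, F z ∂(bergmanMeasure α) = ∫⁻ z in ball 0 1,
      ENNReal.ofReal ((α + 1) / Real.pi * (1 - ‖z‖ ^ 2) ^ α) * F z := by
  rw [bergmanMeasure, lintegral_withDensity_eq_lintegral_mul_non_measurable₀ _
    (Measurable.aemeasurable (by fun_prop)) (by simp)]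
  rfl

theorem lintegral_norm_sq_mul_one_sub_pow {α : ℝ} (hα : -1 < α) {g : ℂ → ℂ}
    (hg : DifferentiableOn ℂ g (ball 0 1)) (j : ℕ) :
    ∫⁻ z, ‖g z‖ₑ ^ 2 * ENNReal.ofReal ((1 - ‖z‖ ^ 2) ^ j) ∂(bergmanMeasure α) =
      ∑' n : ℕ, ENNReal.ofReal (‖taylorCoeff g n‖ ^ 2 *
        ((α + 1) * ProbabilityTheory.beta (n + 1) (α + j + 1))) := by
  have hpi := Real.pi_pos
  have hc : 0 ≤ (α + 1) / Real.pi := div_nonneg (by linarith) hpi.le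
  have hj : (0 : ℝ) ≤ j := Nat.cast_nonneg j
  rw [lintegral_bergmanMeasure]
  have e : ∀ z ∈ ball (0 : ℂ) 1, ENNReal.ofReal ((α + 1) / Real.pi * (1 - ‖z‖ ^ 2) ^ α) *
      (‖g z‖ₑ ^ 2 * ENNReal.ofReal ((1 - ‖z‖ ^ 2) ^ j)) = ENNReal.ofReal ((α + 1) / Real.pi) *
        (‖g z‖ₑ ^ 2 * ENNReal.ofReal ((1 - ‖z‖ ^ 2) ^ (α + j))) := by
    intro z hz
    have h1 : ‖z‖ < 1 := by simpa using hz
    have h2 : 0 < 1 - ‖z‖ ^ 2 := by nlinarith [norm_nonneg z]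
    rw [Real.rpow_add h2, Real.rpow_natCast, ENNReal.ofReal_mul hc,
      ENNReal.ofReal_mul (Real.rpow_nonneg h2.le _)]
    ring
  rw [setLIntegral_congr_fun measurableSet_ball e, lintegral_const_mul' _ _ ENNReal.ofReal_ne_top,
    lintegral_norm_sq_mul_rpow hg (by linarith), ← ENNReal.tsum_mul_left]
  refine tsum_congr fun n => ?_
  rw [enorm_sq_mul_ofReal, ← ENNReal.ofReal_mul hc]
  congr 1
  field_simp

/-- The square of the norm of `z ^ n` in `A²_α`. -/
def bergmanWeight (α : ℝ) (n : ℕ) : ℝ := (α + 1) * ProbabilityTheory.beta (n + 1) (α + 1)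

theorem bergmanWeight_pos {α : ℝ} (hα : -1 < α) (n : ℕ) : 0 < bergmanWeight α n :=
  mul_pos (by linarith) (ProbabilityTheory.beta_pos (by positivity) (by linarith))

theorem lintegral_norm_sq {α : ℝ} (hα : -1 < α) {g : ℂ → ℂ}
    (hg : DifferentiableOn ℂ g (ball 0 1)) :
    ∫⁻ z, ‖g z‖ₑ ^ 2 ∂(bergmanMeasure α) =
      ∑' n : ℕ, ENNReal.ofReal (‖taylorCoeff g n‖ ^ 2 * bergmanWeight α n) := by
  simpa [bergmanWeight] using lintegral_norm_sq_mul_one_sub_pow hα hg 0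

theorem lintegral_norm_sq_mul_one_sub {α : ℝ} (hα : -1 < α) {g : ℂ → ℂ}
    (hg : DifferentiableOn ℂ g (ball 0 1)) :
    ∫⁻ z, ‖g z‖ₑ ^ 2 * ENNReal.ofReal (1 - ‖z‖ ^ 2) ∂(bergmanMeasure α) =
      ∑' n : ℕ, ENNReal.ofReal (‖taylorCoeff g n‖ ^ 2 *
        (bergmanWeight α n * ((α + 1) / (n + α + 2)))) := by
  have h := lintegral_norm_sq_mul_one_sub_pow hα hg 1
  simp only [pow_one, Nat.cast_one] at h
  rw [h]
  refine tsum_congr fun n => ?_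
  rw [show α + 1 + 1 = (α + 1) + 1 by ring, beta_add_one_right (by positivity) (by linarith),
    bergmanWeight, show (n : ℝ) + 1 + (α + 1) = n + α + 2 by ring]
  congr 1
  ring

theorem eLpNorm_two_sq {μ : Measure ℂ} (g : ℂ → ℂ) :
    eLpNorm g 2 μ ^ 2 = ∫⁻ w, ‖g w‖ₑ ^ 2 ∂μ := by
  rw [eLpNorm_eq_lintegral_rpow_enorm_toReal (by norm_num) (by norm_num),
    ← ENNReal.rpow_natCast, ← ENNReal.rpow_mul]
  simp

theorem aestronglyMeasurable_bergmanMeasure {α : ℝ} {g : ℂ → ℂ} (hg : ContinuousOn g (ball 0 1)) :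
    AEStronglyMeasurable g (bergmanMeasure α) :=
  (hg.aestronglyMeasurable measurableSet_ball).mono_ac (withDensity_absolutelyContinuous _ _)

/-- Analytic functions that agree almost everywhere on the disk agree on the disk. -/
theorem eqOn_ball_of_ae_eq {α : ℝ} (hα : -1 < α) {g h : ℂ → ℂ}
    (hg : DifferentiableOn ℂ g (ball 0 1)) (hh : DifferentiableOn ℂ h (ball 0 1))
    (e : g =ᵐ[bergmanMeasure α] h) : EqOn g h (ball 0 1) := by
  intro z hz
  have hz' : ‖z‖ < 1 := by simpa using hz
  obtain ⟨c, hc0, -, hc⟩ := eval_bound hα (ρ := (1 + ‖z‖) / 2) (by linarith [norm_nonneg z])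
    (by linarith)
  have h1 := hc _ (hg.sub hh) z (by rw [mem_ball, dist_zero_right]; linarith)
  have h2 : eLpNorm (g - h) 2 (bergmanMeasure α) = 0 := by
    rw [eLpNorm_congr_ae (g := 0) (by filter_upwards [e] with w hw; simp [hw]), eLpNorm_zero]
  rw [h2, nonpos_iff_eq_zero, mul_eq_zero, or_iff_right hc0, enorm_eq_zero] at h1
  exact sub_eq_zero.1 h1

theorem taylorCoeff_congr {g h : ℂ → ℂ} (e : EqOn g h (ball 0 1)) (n : ℕ) :
    taylorCoeff g n = taylorCoeff h n := by
  have : g =ᶠ[𝓝 0] h := e.eventuallyEq_of_mem (ball_mem_nhds 0 one_pos)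
  rw [taylorCoeff, taylorCoeff, this.iteratedDeriv_eq n]

/-- An analytic representative of an element of `A²_α`. -/
def toFun {α : ℝ} (f : bergmanSpace α) : ℂ → ℂ := f.2.choose

theorem differentiableOn_toFun {α : ℝ} (f : bergmanSpace α) :
    DifferentiableOn ℂ (toFun f) (ball 0 1) := f.2.choose_spec.1

theorem coe_ae_eq_toFun {α : ℝ} (f : bergmanSpace α) : f.1 =ᵐ[bergmanMeasure α] toFun f :=
  f.2.choose_spec.2

theorem toFun_eqOn {α : ℝ} (hα : -1 < α) {f : bergmanSpace α} {g : ℂ → ℂ}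
    (hg : DifferentiableOn ℂ g (ball 0 1)) (e : f.1 =ᵐ[bergmanMeasure α] g) :
    EqOn (toFun f) g (ball 0 1) :=
  eqOn_ball_of_ae_eq hα (differentiableOn_toFun f) hg ((coe_ae_eq_toFun f).symm.trans e)

theorem toFun_add {α : ℝ} (hα : -1 < α) (f g : bergmanSpace α) :
    EqOn (toFun (f + g)) (toFun f + toFun g) (ball 0 1) :=
  toFun_eqOn hα ((differentiableOn_toFun f).add (differentiableOn_toFun g))
    ((Lp.coeFn_add f.1 g.1).trans ((coe_ae_eq_toFun f).add (coe_ae_eq_toFun g)))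

theorem toFun_smul {α : ℝ} (hα : -1 < α) (c : ℂ) (f : bergmanSpace α) :
    EqOn (toFun (c • f)) (c • toFun f) (ball 0 1) :=
  toFun_eqOn hα ((differentiableOn_toFun f).const_smul c)
    ((Lp.coeFn_smul c f.1).trans ((coe_ae_eq_toFun f).const_smul c))

theorem ofReal_norm_sq_eq_lintegral {α : ℝ} (f : bergmanSpace α) :
    ENNReal.ofReal (‖f‖ ^ 2) = ∫⁻ z, ‖toFun f z‖ₑ ^ 2 ∂(bergmanMeasure α) := by
  rw [← eLpNorm_two_sq, ← eLpNorm_congr_ae (coe_ae_eq_toFun f), ENNReal.ofReal_pow (norm_nonneg _),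
    Submodule.coe_norm, Lp.norm_def, ENNReal.ofReal_toReal (Lp.memLp f.1).2.ne]

theorem hasSum_norm_sq {α : ℝ} (hα : -1 < α) (f : bergmanSpace α) :
    HasSum (fun n => ‖taylorCoeff (toFun f) n‖ ^ 2 * bergmanWeight α n) (‖f‖ ^ 2) := by
  have h := lintegral_norm_sq hα (differentiableOn_toFun f)
  rw [← ofReal_norm_sq_eq_lintegral] at h
  have hn : ∀ n, 0 ≤ ‖taylorCoeff (toFun f) n‖ ^ 2 * bergmanWeight α n := fun n => by
    have := bergmanWeight_pos hα n
    positivity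
  have hs := (tsum_ofReal_lt_top_iff hn).1 (h ▸ ENNReal.ofReal_lt_top)
  rw [← ENNReal.ofReal_tsum_of_nonneg hn hs,
    ENNReal.ofReal_eq_ofReal_iff (by positivity) (tsum_nonneg hn)] at h
  rw [h]
  exact hs.hasSum

theorem exists_bergmanSpace_of_summable {α : ℝ} (hα : -1 < α) {g : ℂ → ℂ}
    (hg : DifferentiableOn ℂ g (ball 0 1))
    (hs : Summable fun n => ‖taylorCoeff g n‖ ^ 2 * bergmanWeight α n) :
    ∃ f : bergmanSpace α, f.1 =ᵐ[bergmanMeasure α] g := by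
  have hm : MemLp g 2 (bergmanMeasure α) := by
    refine ⟨aestronglyMeasurable_bergmanMeasure hg.continuousOn, ?_⟩
    have h : eLpNorm g 2 (bergmanMeasure α) ^ 2 < ⊤ := by
      rw [eLpNorm_two_sq, lintegral_norm_sq hα hg,
        tsum_ofReal_lt_top_iff fun n => by have := bergmanWeight_pos hα n; positivity]
      exact hs
    exact (ENNReal.pow_lt_top_iff.1 h).resolve_right two_ne_zero
  exact ⟨⟨hm.toLp g, g, hg, hm.coeFn_toLp⟩, hm.coeFn_toLp⟩

/-! ### The coordinates of `A²_α` -/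

theorem taylorCoeff_add {g h : ℂ → ℂ} (hg : DifferentiableOn ℂ g (ball 0 1))
    (hh : DifferentiableOn ℂ h (ball 0 1)) (n : ℕ) :
    taylorCoeff (g + h) n = taylorCoeff g n + taylorCoeff h n := by
  have h0 : ball (0 : ℂ) 1 ∈ 𝓝 0 := ball_mem_nhds 0 one_pos
  rw [taylorCoeff, taylorCoeff, taylorCoeff,
    iteratedDeriv_add (hg.analyticAt h0).contDiffAt (hh.analyticAt h0).contDiffAt, mul_add]

theorem taylorCoeff_smul (g : ℂ → ℂ) (c : ℂ) (n : ℕ) :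
    taylorCoeff (c • g) n = c * taylorCoeff g n := by
  rw [taylorCoeff, taylorCoeff, iteratedDeriv_const_smul_field]
  simp only [smul_eq_mul]
  ring

theorem taylorCoeff_pow (m n : ℕ) :
    taylorCoeff (fun z => z ^ m) n = if n = m then 1 else 0 := by
  rw [taylorCoeff, iteratedDeriv_pow]
  rcases lt_trichotomy n m with h | rfl | h
  · rw [if_neg h.ne, zero_pow (by omega)]
    simp
  · rw [if_pos rfl, Nat.sub_self, pow_zero, mul_one, Nat.descFactorial_self]
    exact inv_mul_cancel₀ (by exact_mod_cast n.factorial_ne_zero)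
  · rw [if_neg h.ne', Nat.descFactorial_of_lt h]
    simp

/-- The Taylor coefficients of an element of `A²_α`. -/
def coeff {α : ℝ} (f : bergmanSpace α) (n : ℕ) : ℂ := taylorCoeff (toFun f) n

theorem coeff_add {α : ℝ} (hα : -1 < α) (f g : bergmanSpace α) (n : ℕ) :
    coeff (f + g) n = coeff f n + coeff g n := by
  rw [coeff, taylorCoeff_congr (toFun_add hα f g),
    taylorCoeff_add (differentiableOn_toFun f) (differentiableOn_toFun g)]
  rfl

theorem coeff_smul {α : ℝ} (hα : -1 < α) (c : ℂ) (f : bergmanSpace α) (n : ℕ) :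
    coeff (c • f) n = c * coeff f n := by
  rw [coeff, taylorCoeff_congr (toFun_smul hα c f), taylorCoeff_smul]
  rfl

theorem memℓp_coeff {α : ℝ} (hα : -1 < α) (f : bergmanSpace α) :
    Memℓp (fun n => (√(bergmanWeight α n) : ℂ) * coeff f n) 2 := by
  rw [memℓp_gen_iff (by norm_num)]
  refine (hasSum_norm_sq hα f).summable.congr fun n => ?_
  rw [ENNReal.toReal_ofNat, Real.rpow_ofNat, norm_mul, Complex.norm_real, Real.norm_eq_abs, mul_pow,
    sq_abs, Real.sq_sqrt (bergmanWeight_pos hα n).le, mul_comm]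
  rfl

/-- The isometry of `A²_α` into `ℓ²` given by the normalized Taylor coefficients. -/
def coordIsometry {α : ℝ} (hα : -1 < α) :
    bergmanSpace α →ₗᵢ[ℂ] lp (fun _ : ℕ => ℂ) 2 where
  toFun f := ⟨_, memℓp_coeff hα f⟩
  map_add' f g := by
    ext n
    change (√(bergmanWeight α n) : ℂ) * coeff (f + g) n = (√(bergmanWeight α n) : ℂ) * coeff f n +
      (√(bergmanWeight α n) : ℂ) * coeff g n
    rw [coeff_add hα, mul_add]
  map_smul' c f := by
    ext n
    change (√(bergmanWeight α n) : ℂ) * coeff (c • f) n =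
      c * ((√(bergmanWeight α n) : ℂ) * coeff f n)
    rw [coeff_smul hα]
    ring
  norm_map' f := by
    have h1 := hasSum_norm_sq hα f
    have h2 := lp.hasSum_norm (p := 2) (by norm_num)
      (⟨_, memℓp_coeff hα f⟩ : lp (fun _ : ℕ => ℂ) 2)
    simp only [ENNReal.toReal_ofNat, Real.rpow_ofNat] at h2
    refine (pow_left_inj₀ (norm_nonneg _) (norm_nonneg _) two_ne_zero).1 (h2.unique ?_)
    convert h1 using 2 with n
    rw [norm_mul, Complex.norm_real, Real.norm_eq_abs, mul_pow, sq_abs,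
      Real.sq_sqrt (bergmanWeight_pos hα n).le, mul_comm]
    rfl

theorem hasSum_inner {α : ℝ} (hα : -1 < α) (f g : bergmanSpace α) :
    HasSum (fun n => (bergmanWeight α n : ℂ) * (star (coeff f n) * coeff g n)) (inner ℂ f g) := by
  rw [← (coordIsometry hα).inner_map_map]
  have e : ∀ n, (bergmanWeight α n : ℂ) * (star (coeff f n) * coeff g n) =
      inner ℂ (coordIsometry hα f n) (coordIsometry hα g n) := by
    intro n
    change _ = inner ℂ ((√(bergmanWeight α n) : ℂ) * coeff f n)
      ((√(bergmanWeight α n) : ℂ) * coeff g n)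
    rw [RCLike.inner_apply, map_mul, Complex.conj_ofReal]
    have : (bergmanWeight α n : ℂ) = √(bergmanWeight α n) * √(bergmanWeight α n) := by
      rw [← Complex.ofReal_mul, Real.mul_self_sqrt (bergmanWeight_pos hα n).le]
    rw [this, Complex.star_def]
    ring
  simp only [e]
  exact lp.hasSum_inner (coordIsometry hα f) (coordIsometry hα g)

theorem norm_coeff_sq_mul_le {α : ℝ} (hα : -1 < α) (f : bergmanSpace α) (n : ℕ) :
    ‖coeff f n‖ ^ 2 * bergmanWeight α n ≤ ‖f‖ ^ 2 :=
  le_hasSum (hasSum_norm_sq hα f) n fun m _ => by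
    have := bergmanWeight_pos hα m
    positivity

/-- The `n`-th Taylor coefficient as a continuous linear functional on `A²_α`. -/
def coeffCLM {α : ℝ} (hα : -1 < α) (n : ℕ) : bergmanSpace α →L[ℂ] ℂ :=
  LinearMap.mkContinuous
    { toFun := fun f => coeff f n
      map_add' := fun f g => coeff_add hα f g n
      map_smul' := fun c f => coeff_smul hα c f n }
    (√(bergmanWeight α n))⁻¹ fun f => by
      have hw := bergmanWeight_pos hα n
      change ‖coeff f n‖ ≤ _
      rw [le_inv_mul_iff₀ (Real.sqrt_pos.2 hw)]
      refine (pow_le_pow_iff_left₀ (by positivity) (norm_nonneg _) two_ne_zero).1 ?_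
      rw [mul_pow, Real.sq_sqrt hw.le, mul_comm]
      exact norm_coeff_sq_mul_le hα f n

theorem coeffCLM_apply {α : ℝ} (hα : -1 < α) (n : ℕ) (f : bergmanSpace α) :
    coeffCLM hα n f = coeff f n := rfl

theorem exists_monomial {α : ℝ} (hα : -1 < α) (m : ℕ) : ∃ f : bergmanSpace α,
    EqOn (toFun f) (fun z => z ^ m) (ball 0 1) := by
  have hd : DifferentiableOn ℂ (fun z : ℂ => z ^ m) (ball 0 1) := by fun_prop
  obtain ⟨f, hf⟩ := exists_bergmanSpace_of_summable hα hd
    (summable_of_ne_finset_zero (s := {m}) fun n hn => by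
      rw [taylorCoeff_pow, if_neg (by simpa using hn)]
      simp)
  exact ⟨f, toFun_eqOn hα hd hf⟩

/-- The monomial `z ^ m` as an element of `A²_α`. -/
def monomial {α : ℝ} (hα : -1 < α) (m : ℕ) : bergmanSpace α := (exists_monomial hα m).choose

theorem toFun_monomial {α : ℝ} (hα : -1 < α) (m : ℕ) :
    EqOn (toFun (monomial hα m)) (fun z => z ^ m) (ball 0 1) := (exists_monomial hα m).choose_spec

theorem coeff_monomial {α : ℝ} (hα : -1 < α) (m n : ℕ) :
    coeff (monomial hα m) n = if n = m then 1 else 0 := by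
  rw [coeff, taylorCoeff_congr (toFun_monomial hα m), taylorCoeff_pow]

theorem coeff_sum_smul_monomial {α : ℝ} (hα : -1 < α) (N : ℕ) (c : ℕ → ℂ) (n : ℕ) :
    coeff (∑ m ∈ Finset.range N, c m • monomial hα m) n = if n < N then c n else 0 := by
  rw [← coeffCLM_apply hα, map_sum]
  simp only [map_smul, coeffCLM_apply, coeff_monomial, smul_eq_mul, mul_ite, mul_one, mul_zero,
    Finset.sum_ite_eq, Finset.mem_range]

/-- The Taylor polynomials, as an operator on `A²_α`. -/
def truncation {α : ℝ} (hα : -1 < α) (N : ℕ) : bergmanSpace α →L[ℂ] bergmanSpace α :=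
  ∑ m ∈ Finset.range N, (coeffCLM hα m).smulRight (monomial hα m)

theorem truncation_apply {α : ℝ} (hα : -1 < α) (N : ℕ) (f : bergmanSpace α) :
    truncation hα N f = ∑ m ∈ Finset.range N, coeff f m • monomial hα m := by
  simp only [truncation, sum_apply, ContinuousLinearMap.smulRight_apply,
    coeffCLM_apply]

theorem isCompactOperator_truncation {α : ℝ} (hα : -1 < α) (N : ℕ) :
    IsCompactOperator (truncation hα N) :=
  (compactOperator (RingHom.id ℂ) (bergmanSpace α) (bergmanSpace α)).sum_mem fun m _ =>
    isCompactOperator_smulRight (coeffCLM hα m) (monomial hα m)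

theorem coeff_sub_truncation {α : ℝ} (hα : -1 < α) (N : ℕ) (f : bergmanSpace α) (n : ℕ) :
    coeff (f - truncation hα N f) n = if n < N then 0 else coeff f n := by
  have h : coeff (f - truncation hα N f) n = coeff f n - coeff (truncation hα N f) n :=
    map_sub (coeffCLM hα n) _ _
  rw [h, truncation_apply, coeff_sum_smul_monomial]
  split_ifs <;> simp

theorem tendsto_truncation {α : ℝ} (hα : -1 < α) (f : bergmanSpace α) :
    Tendsto (fun N => truncation hα N f) atTop (𝓝 f) := by
  rw [tendsto_iff_norm_sub_tendsto_zero]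
  have h0 := hasSum_norm_sq hα f
  have h1 : ∀ N, ‖truncation hα N f - f‖ ^ 2 =
      ‖f‖ ^ 2 - ∑ n ∈ Finset.range N, ‖coeff f n‖ ^ 2 * bergmanWeight α n := by
    intro N
    rw [norm_sub_rev]
    refine (hasSum_norm_sq hα _).unique ?_
    have h2 := h0.sub (hasSum_sum_of_ne_finset_zero (s := Finset.range N)
      (f := fun n => if n < N then ‖coeff f n‖ ^ 2 * bergmanWeight α n else 0)
      fun n hn => if_neg (by simpa using hn))
    rw [Finset.sum_congr rfl fun n hn => if_pos (Finset.mem_range.1 hn)] at h2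
    have e : ∀ n, ‖taylorCoeff (toFun (f - truncation hα N f)) n‖ ^ 2 * bergmanWeight α n =
        ‖taylorCoeff (toFun f) n‖ ^ 2 * bergmanWeight α n -
          if n < N then ‖coeff f n‖ ^ 2 * bergmanWeight α n else 0 := by
      intro n
      change ‖coeff (f - truncation hα N f) n‖ ^ 2 * _ = ‖coeff f n‖ ^ 2 * _ - _
      rw [coeff_sub_truncation]
      split_ifs <;> simp
    simp only [e]
    exact h2
  have h2 : Tendsto (fun N => ‖truncation hα N f - f‖ ^ 2) atTop (𝓝 0) := by
    simp only [h1]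
    have := h0.tendsto_sum_nat.const_sub (‖f‖ ^ 2)
    rwa [sub_self] at this
  have h3 := h2.sqrt
  simpa [Real.sqrt_sq (norm_nonneg _)] using h3

/-! ### Defect operators on `A²_α` -/

theorem toFun_mulOp {α : ℝ} (hα : -1 < α) {φ : ℂ → ℂ} (hφ : φ ∈ hInftyBall) (f : bergmanSpace α) :
    EqOn (toFun (mulOp α hφ f)) (fun z => φ z * toFun f z) (ball 0 1) := by
  refine toFun_eqOn hα (hφ.1.mul (differentiableOn_toFun f)) ?_
  have h : ((mulOp α hφ f).1 : ℂ → ℂ) =ᵐ[bergmanMeasure α] fun z => φ z * f.1 z :=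
    (memLp_mul hφ f.1).coeFn_toLp
  filter_upwards [h, coe_ae_eq_toFun f] with z h1 h2
  rw [h1, h2]

theorem norm_mulOp_le {α : ℝ} {φ : ℂ → ℂ} (hφ : φ ∈ hInftyBall) (f : bergmanSpace α) :
    ‖mulOp α hφ f‖ ≤ ‖f‖ := by
  have h := (mulOp α hφ).le_of_opNorm_le (LinearMap.mkContinuous_norm_le _ zero_le_one _) f
  rwa [one_mul] at h

theorem inner_defectConj_left {α : ℝ} {φ : ℂ → ℂ} (hφ : φ ∈ hInftyBall) (f g : bergmanSpace α) :
    inner ℂ (defectConj α hφ f) g = inner ℂ f (defectConj α hφ g) :=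
  inner_defectOp_left _ f g

/-- Splits `‖f‖²` as `‖φ f‖² + ‖D f‖²` and compares with the pointwise splitting of `|f|²`.
Thereafter, comparing defect operators amounts to comparing `1 - |φ|²` pointwise. -/
theorem ofReal_norm_defectConj_sq {α : ℝ} (hα : -1 < α) {φ : ℂ → ℂ} (hφ : φ ∈ hInftyBall)
    (f : bergmanSpace α) : ENNReal.ofReal (‖defectConj α hφ f‖ ^ 2) =
      ∫⁻ z, ‖toFun f z‖ₑ ^ 2 * ENNReal.ofReal (1 - ‖φ z‖ ^ 2) ∂(bergmanMeasure α) := by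
  have h1 : ‖f‖ ^ 2 = ‖mulOp α hφ f‖ ^ 2 + ‖defectConj α hφ f‖ ^ 2 := by
    have := norm_defectOp_sq (norm_mulOp_le hφ) f
    rw [defectConj, this]
    ring
  have h2 : ∫⁻ z, ‖toFun f z‖ₑ ^ 2 ∂(bergmanMeasure α) =
      ∫⁻ z, ‖toFun (mulOp α hφ f) z‖ₑ ^ 2 +
        ‖toFun f z‖ₑ ^ 2 * ENNReal.ofReal (1 - ‖φ z‖ ^ 2) ∂(bergmanMeasure α) := by
    refine lintegral_congr_ae ?_
    filter_upwards [ae_bergmanMeasure_mem α] with z hz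
    have h3 : 0 ≤ 1 - ‖φ z‖ ^ 2 := by nlinarith [hφ.2 z hz, norm_nonneg (φ z)]
    rw [toFun_mulOp hα hφ f hz, enorm_sq_mul_ofReal, ← ofReal_norm, ← ofReal_norm,
      ← ENNReal.ofReal_pow (norm_nonneg _), ← ENNReal.ofReal_pow (norm_nonneg _),
      ← ENNReal.ofReal_add (by positivity) (by positivity), norm_mul]
    congr 1
    ring
  rw [lintegral_add_left', ← ofReal_norm_sq_eq_lintegral, ← ofReal_norm_sq_eq_lintegral, h1,
    ENNReal.ofReal_add (by positivity) (by positivity)] at h2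
  · exact (ENNReal.add_right_inj ENNReal.ofReal_ne_top).1 h2
  · exact ((aestronglyMeasurable_bergmanMeasure
      (differentiableOn_toFun _).continuousOn).enorm).pow_const 2

/-- Comparison of defect operators. -/
theorem norm_defectConj_sq_le {α : ℝ} (hα : -1 < α) {φ ψ : ℂ → ℂ} (hφ : φ ∈ hInftyBall)
    (hψ : ψ ∈ hInftyBall) {C : ℝ} (hC : 0 ≤ C)
    (h : ∀ z ∈ ball (0 : ℂ) 1, 1 - ‖φ z‖ ^ 2 ≤ C * (1 - ‖ψ z‖ ^ 2)) (f : bergmanSpace α) :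
    ‖defectConj α hφ f‖ ^ 2 ≤ C * ‖defectConj α hψ f‖ ^ 2 := by
  rw [← ENNReal.ofReal_le_ofReal_iff (by positivity), ENNReal.ofReal_mul hC,
    ofReal_norm_defectConj_sq hα, ofReal_norm_defectConj_sq hα,
    ← lintegral_const_mul' _ _ ENNReal.ofReal_ne_top]
  refine lintegral_mono_ae ?_
  filter_upwards [ae_bergmanMeasure_mem α] with z hz
  rw [mul_left_comm, ← ENNReal.ofReal_mul hC]
  gcongr
  exact h z hz

/-- The bound `|⟪g, f⟫| ≤ K ‖D f‖` that characterizes the range survives when `‖D f‖` is replaced by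
something that dominates it. -/
theorem mem_range_defectConj_of_le {α : ℝ} {φ ψ : ℂ → ℂ} {hφ : φ ∈ hInftyBall}
    {hψ : ψ ∈ hInftyBall} {C : ℝ}
    (h : ∀ f, ‖defectConj α hφ f‖ ^ 2 ≤ C * ‖defectConj α hψ f‖ ^ 2) {g : bergmanSpace α}
    (hg : ∃ f, defectConj α hφ f = g) : ∃ f, defectConj α hψ f = g := by
  rw [mem_range_iff_exists_bound (inner_defectConj_left _)] at hg ⊢
  obtain ⟨K, hK⟩ := hg
  refine ⟨|K| * √C, fun f => (hK f).trans ?_⟩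
  have h1 : ‖defectConj α hφ f‖ ≤ √C * ‖defectConj α hψ f‖ := by
    rw [← Real.sqrt_sq (norm_nonneg (defectConj α hψ f)), ← Real.sqrt_mul' _ (sq_nonneg _)]
    exact Real.le_sqrt_of_sq_le (h f)
  calc K * ‖defectConj α hφ f‖ ≤ |K| * ‖defectConj α hφ f‖ := by gcongr; exact le_abs_self K
    _ ≤ |K| * (√C * ‖defectConj α hψ f‖) := by gcongr
    _ = _ := by ring

theorem id_mem_hInftyBall : (fun z : ℂ => z) ∈ hInftyBall :=
  ⟨differentiableOn_id, fun z hz => by simpa using (mem_ball.1 hz).le⟩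

theorem hasSum_norm_defectConj_id_sq {α : ℝ} (hα : -1 < α) (f : bergmanSpace α) :
    HasSum (fun n : ℕ => ‖coeff f n‖ ^ 2 * (bergmanWeight α n * ((α + 1) / (n + α + 2))))
      (‖defectConj α id_mem_hInftyBall f‖ ^ 2) := by
  have h := ofReal_norm_defectConj_sq hα id_mem_hInftyBall f
  rw [lintegral_norm_sq_mul_one_sub hα (differentiableOn_toFun f)] at h
  have hn : ∀ n : ℕ, 0 ≤ ‖taylorCoeff (toFun f) n‖ ^ 2 *
      (bergmanWeight α n * ((α + 1) / (n + α + 2))) := fun n => by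
    have h1 := bergmanWeight_pos hα n
    have h2 : 0 < α + 1 := by linarith
    have h3 : 0 < (n : ℝ) + α + 2 := by linarith [Nat.cast_nonneg (α := ℝ) n]
    positivity
  have hs := (tsum_ofReal_lt_top_iff hn).1 (h ▸ ENNReal.ofReal_lt_top)
  rw [← ENNReal.ofReal_tsum_of_nonneg hn hs,
    ENNReal.ofReal_eq_ofReal_iff (by positivity) (tsum_nonneg hn)] at h
  rw [h]
  exact hs.hasSum

theorem injective_defectConj_id {α : ℝ} (hα : -1 < α) :
    Function.Injective (defectConj α id_mem_hInftyBall) := by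
  rw [injective_iff_map_eq_zero]
  intro f hf
  have h := hasSum_norm_defectConj_id_sq hα f
  have h1 : 0 < α + 1 := by linarith
  have h3 : ∀ n : ℕ, 0 < (n : ℝ) + α + 2 := fun n => by linarith [Nat.cast_nonneg (α := ℝ) n]
  rw [hf, norm_zero, zero_pow two_ne_zero, hasSum_zero_iff_of_nonneg fun n => by
    have := bergmanWeight_pos hα n; have := h3 n; positivity] at h
  have hc : ∀ n, ‖coeff f n‖ ^ 2 = 0 := fun n => by
    have := congrFun h n
    have hw := bergmanWeight_pos hα n
    have := h3 n
    exact (mul_eq_zero.1 (congrFun h n)).resolve_right (by positivity)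
  have hz := hasSum_norm_sq hα f
  have e : ∀ n, ‖taylorCoeff (toFun f) n‖ ^ 2 * bergmanWeight α n = 0 := fun n => by
    rw [show ‖taylorCoeff (toFun f) n‖ ^ 2 = 0 from hc n, zero_mul]
  simp only [e] at hz
  simpa using hz.unique hasSum_zero

/-- The diagonal factors decrease to zero, so composing with Taylor truncation approximates the
operator in norm, with error at most `√((α + 1) / (N + α + 2))`, by finite-rank operators. -/
theorem isCompactOperator_defectConj_id {α : ℝ} (hα : -1 < α) :
    IsCompactOperator (defectConj α id_mem_hInftyBall) := by
  set S := defectConj α id_mem_hInftyBall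
  have h1 : 0 < α + 1 := by linarith
  have h3 : ∀ n : ℕ, 0 < (n : ℝ) + α + 2 := fun n => by linarith [Nat.cast_nonneg (α := ℝ) n]
  have hle : ∀ N f, ‖S (f - truncation hα N f)‖ ^ 2 ≤ (α + 1) / (N + α + 2) * ‖f‖ ^ 2 := by
    intro N f
    refine hasSum_le (fun n => ?_) (hasSum_norm_defectConj_id_sq hα (f - truncation hα N f))
      ((hasSum_norm_sq hα f).mul_left ((α + 1) / (N + α + 2)))
    have hw := bergmanWeight_pos hα n
    have := h3 N
    rw [coeff_sub_truncation]
    split_ifs with hn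
    · rw [norm_zero, zero_pow two_ne_zero, zero_mul]
      positivity
    · have hNn : (N : ℝ) ≤ n := by exact_mod_cast not_lt.1 hn
      change ‖coeff f n‖ ^ 2 * _ ≤ _ * (‖coeff f n‖ ^ 2 * _)
      calc _ ≤ ‖coeff f n‖ ^ 2 * (bergmanWeight α n * ((α + 1) / (N + α + 2))) := by gcongr
        _ = _ := by ring
  have hlim : Tendsto (fun N : ℕ => S.comp (truncation hα N)) atTop (𝓝 S) := by
    refine (tendsto_iff_norm_sub_tendsto_zero (E := bergmanSpace α →L[ℂ] bergmanSpace α)).2 ?_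
    have h0 : Tendsto (fun N : ℕ => √((α + 1) / (N + α + 2))) atTop (𝓝 0) := by
      have : Tendsto (fun N : ℕ => (α + 1) / ((N : ℝ) + α + 2)) atTop (𝓝 0) := by
        refine Tendsto.div_atTop tendsto_const_nhds ?_
        exact tendsto_atTop_add_const_right _ _
          (tendsto_atTop_add_const_right _ _ tendsto_natCast_atTop_atTop)
      simpa using this.sqrt
    refine squeeze_zero (fun N => ContinuousLinearMap.opNorm_nonneg _) (fun N => ?_) h0
    refine ContinuousLinearMap.opNorm_le_bound _ (Real.sqrt_nonneg _) fun f => ?_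
    have e : (S.comp (truncation hα N) - S) f = -S (f - truncation hα N f) := by
      rw [map_sub, neg_sub]
      rfl
    have hp : 0 ≤ (α + 1) / (N + α + 2) := (div_pos h1 (h3 N)).le
    rw [e, norm_neg, ← Real.sqrt_sq (norm_nonneg f), ← Real.sqrt_mul hp]
    exact Real.le_sqrt_of_sq_le (hle N f)
  exact isCompactOperator_of_tendsto hlim (Eventually.of_forall fun N =>
    (isCompactOperator_truncation hα N).clm_comp S)

/-- The range of the defect operator of multiplication by `z`. -/
theorem mem_range_defectConj_id_iff {α : ℝ} (hα : -1 < α) (g : bergmanSpace α) :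
    (∃ f, defectConj α id_mem_hInftyBall f = g) ↔
      Summable fun n : ℕ => ‖coeff g n‖ ^ 2 * ((n + α + 2) * bergmanWeight α n) := by
  have h1 : 0 < α + 1 := by linarith
  have h3 : ∀ n : ℕ, 0 < (n : ℝ) + α + 2 := fun n => by linarith [Nat.cast_nonneg (α := ℝ) n]
  rw [mem_range_iff_exists_bound (inner_defectConj_left _)]
  constructor
  · rintro ⟨C, hC⟩
    refine summable_of_sum_range_le (c := C ^ 2 * (α + 1)) (fun n => ?_) fun N => ?_
    · have := bergmanWeight_pos hα n
      have := h3 n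
      positivity
    set A := ∑ n ∈ Finset.range N, ‖coeff g n‖ ^ 2 * ((n + α + 2) * bergmanWeight α n) with hA
    have hA0 : 0 ≤ A := Finset.sum_nonneg fun n _ => by
      have := bergmanWeight_pos hα n
      have := h3 n
      positivity
    -- This test polynomial makes `⟪g, f⟫ = A` and `‖D f‖² = (α + 1) A`, so the hypothesis becomes
    -- `A² ≤ C² (α + 1) A`, a bound on `A` free of `N`.
    set c : ℕ → ℂ := fun n => ((n + α + 2 : ℝ) : ℂ) * coeff g n with hc
    set f := ∑ m ∈ Finset.range N, c m • monomial hα m with hf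
    have hcf : ∀ n, coeff f n = if n < N then c n else 0 := coeff_sum_smul_monomial hα N c
    have hin : inner ℂ g f = (A : ℂ) := by
      refine (hasSum_inner hα g f).unique ?_
      have : HasSum (fun n => (bergmanWeight α n : ℂ) * (star (coeff g n) * coeff f n))
          (∑ n ∈ Finset.range N, (bergmanWeight α n : ℂ) * (star (coeff g n) * coeff f n)) :=
        hasSum_sum_of_ne_finset_zero fun n hn => by rw [hcf, if_neg (by simpa using hn), mul_zero, mul_zero]
      convert this using 1
      rw [hA, Complex.ofReal_sum]
      refine Finset.sum_congr rfl fun n hn => ?_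
      have h5 : ((‖coeff g n‖ ^ 2 : ℝ) : ℂ) = star (coeff g n) * coeff g n := by
        rw [Complex.star_def, Complex.conj_mul', Complex.ofReal_pow]
      rw [hcf, if_pos (Finset.mem_range.1 hn), Complex.ofReal_mul, h5, hc]
      push_cast
      ring
    have hS : ‖defectConj α id_mem_hInftyBall f‖ ^ 2 = (α + 1) * A := by
      refine (hasSum_norm_defectConj_id_sq hα f).unique ?_
      have : HasSum
          (fun n : ℕ => ‖coeff f n‖ ^ 2 * (bergmanWeight α n * ((α + 1) / (n + α + 2))))
          (∑ n ∈ Finset.range N,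
            ‖coeff f n‖ ^ 2 * (bergmanWeight α n * ((α + 1) / (n + α + 2)))) :=
        hasSum_sum_of_ne_finset_zero fun n hn => by
          rw [hcf, if_neg (by simpa using hn), norm_zero, zero_pow two_ne_zero, zero_mul]
      convert this using 1
      rw [hA, Finset.mul_sum]
      refine Finset.sum_congr rfl fun n hn => ?_
      have h4 := h3 n
      rw [hcf, if_pos (Finset.mem_range.1 hn), hc, norm_mul, Complex.norm_real, Real.norm_eq_abs,
        mul_pow, sq_abs]
      field_simp
    have hb := hC f
    rw [hin, Complex.norm_real, Real.norm_eq_abs, abs_of_nonneg hA0] at hb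
    have hb2 : A ^ 2 ≤ C ^ 2 * ((α + 1) * A) := by
      rw [← hS, ← mul_pow]
      exact pow_le_pow_left₀ hA0 hb 2
    rcases hA0.eq_or_lt with h0 | h0
    · rw [← h0]
      positivity
    · refine le_of_mul_le_mul_right ?_ h0
      linarith
  · intro hs
    set B := ∑' n : ℕ, ‖coeff g n‖ ^ 2 * ((n + α + 2) * bergmanWeight α n) with hB
    refine ⟨√(B / (α + 1)), fun f => ?_⟩
    refine le_of_tendsto ((hasSum_inner hα g f).norm) (Eventually.of_forall fun s => ?_)
    have hS := hasSum_norm_defectConj_id_sq hα f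
    rw [← Real.sqrt_sq (norm_nonneg (defectConj α id_mem_hInftyBall f)),
      ← Real.sqrt_mul' _ (sq_nonneg _)]
    refine Real.le_sqrt_of_sq_le ?_
    -- Cauchy–Schwarz with the weight split so that `g` receives the factor `n + α + 2` and `f` its
    -- inverse, which is the weight of `‖D f‖²` up to `α + 1`.
    set u : ℕ → ℝ := fun n => ‖coeff g n‖ * √((n + α + 2) * bergmanWeight α n) with hu
    set v : ℕ → ℝ := fun n => ‖coeff f n‖ * √(bergmanWeight α n / (n + α + 2)) with hv
    have huv : ∀ n, ‖(bergmanWeight α n : ℂ) * (star (coeff g n) * coeff f n)‖ = u n * v n := by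
      intro n
      have hw := bergmanWeight_pos hα n
      have h4 := h3 n
      have h5 : √((n + α + 2) * bergmanWeight α n) * √(bergmanWeight α n / (n + α + 2)) =
          bergmanWeight α n := by
        rw [← Real.sqrt_mul (by positivity), Real.sqrt_eq_iff_mul_self_eq (by positivity) hw.le]
        field_simp
      rw [norm_mul, norm_mul, norm_star, Complex.norm_real, Real.norm_eq_abs, abs_of_pos hw]
      calc _ = ‖coeff g n‖ * ‖coeff f n‖ * bergmanWeight α n := by ring
        _ = _ := by rw [← h5]; ring
    have hu2 : ∀ n, u n ^ 2 = ‖coeff g n‖ ^ 2 * ((n + α + 2) * bergmanWeight α n) := by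
      intro n
      have hw := bergmanWeight_pos hα n
      have h4 := h3 n
      rw [hu, mul_pow, Real.sq_sqrt (by positivity)]
    have hv2 : ∀ n, v n ^ 2 = (α + 1)⁻¹ *
        (‖coeff f n‖ ^ 2 * (bergmanWeight α n * ((α + 1) / (n + α + 2)))) := by
      intro n
      have hw := bergmanWeight_pos hα n
      have h4 := h3 n
      rw [hv, mul_pow, Real.sq_sqrt (by positivity)]
      field_simp
    have hsu : ∑ n ∈ s, u n ^ 2 ≤ B := by
      simp only [hu2]
      exact hs.sum_le_tsum s fun n _ => by rw [← hu2]; positivity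
    have hsv : ∑ n ∈ s, v n ^ 2 ≤ (α + 1)⁻¹ * ‖defectConj α id_mem_hInftyBall f‖ ^ 2 := by
      simp only [hv2]
      exact sum_le_hasSum s (fun n _ => by rw [← hv2]; positivity) (hS.mul_left _)
    calc ‖∑ n ∈ s, (bergmanWeight α n : ℂ) * (star (coeff g n) * coeff f n)‖ ^ 2
        ≤ (∑ n ∈ s, u n * v n) ^ 2 := by
          refine pow_le_pow_left₀ (norm_nonneg _) ((norm_sum_le _ _).trans_eq ?_) 2
          exact Finset.sum_congr rfl fun n _ => huv n
      _ ≤ (∑ n ∈ s, u n ^ 2) * ∑ n ∈ s, v n ^ 2 := Finset.sum_mul_sq_le_sq_mul_sq s u v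
      _ ≤ B * ((α + 1)⁻¹ * ‖defectConj α id_mem_hInftyBall f‖ ^ 2) := by
          refine mul_le_mul hsu hsv (Finset.sum_nonneg fun n _ => sq_nonneg _) ?_
          exact (Finset.sum_nonneg fun n _ => sq_nonneg _).trans hsu
      _ = _ := by rw [div_eq_mul_inv]; ring

theorem subBergmanConj_id_eq {α : ℝ} (hα : -1 < α) {k : ℕ}
    (hk : -1 < 2 * (k : ℝ) + (α - 1)) :
    subBergmanConj α id_mem_hInftyBall = genBergman (α - 1) k := by
  ext g
  have h1 : 0 < α + 1 := by linarith
  have hiff : ∀ f : bergmanSpace α, DifferentiableOn ℂ g (ball 0 1) → f.1 =ᵐ[bergmanMeasure α] g →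
      ((∃ h, defectConj α id_mem_hInftyBall h = f) ↔ g ∈ genBergman (α - 1) k) := by
    intro f hg hf
    rw [mem_range_defectConj_id_iff hα, mem_genBergman_sub_one_iff hα hk hg]
    refine Iff.trans (summable_congr fun n => ?_) (summable_mul_left_iff h1.ne')
    rw [coeff, taylorCoeff_congr (toFun_eqOn hα hg hf), bergmanWeight]
    ring
  constructor
  · rintro ⟨hg, h, hh⟩
    exact (hiff _ hg hh).1 ⟨h, rfl⟩
  · intro hgm
    have hg : DifferentiableOn ℂ g (ball 0 1) := hgm.1
    have hs := (mem_genBergman_sub_one_iff hα hk hg).1 hgm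
    -- The function must first be seen to lie in `A²_α`; this follows from `α + 1 ≤ n + α + 2`.
    obtain ⟨f, hf⟩ := exists_bergmanSpace_of_summable hα hg
      (Summable.of_nonneg_of_le (fun n => by have := bergmanWeight_pos hα n; positivity)
        (fun n => by
          have hB := ProbabilityTheory.beta_pos (α := (n : ℝ) + 1) (β := α + 1) (by positivity) h1
          rw [bergmanWeight]
          exact mul_le_mul_of_nonneg_left (mul_le_mul_of_nonneg_right
            (by linarith [Nat.cast_nonneg (α := ℝ) n]) hB.le) (by positivity)) hs)
    obtain ⟨h, hh⟩ := (hiff f hg hf).2 hgm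
    exact ⟨hg, h, hh ▸ hf⟩

/-! ### Reproducing kernels -/

/-- Evaluation at a point of the disk, as a continuous linear functional on `A²_α`. -/
theorem exists_evalCLM {α : ℝ} (hα : -1 < α) {z : ℂ} (hz : z ∈ ball (0 : ℂ) 1) :
    ∃ L : bergmanSpace α →L[ℂ] ℂ, ∀ f, L f = toFun f z := by
  have hz' : ‖z‖ < 1 := by simpa using hz
  obtain ⟨c, hc0, hct, hc⟩ := eval_bound hα (ρ := (1 + ‖z‖) / 2) (by linarith [norm_nonneg z])
    (by linarith)
  have hcr : 0 < c.toReal := ENNReal.toReal_pos hc0 hct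
  refine ⟨LinearMap.mkContinuous
    { toFun := fun f => toFun f z
      map_add' := fun f g => toFun_add hα f g hz
      map_smul' := fun a f => toFun_smul hα a f hz } c.toReal⁻¹ fun f => ?_, fun f => rfl⟩
  have h := hc (toFun f) (differentiableOn_toFun f) z (by rw [mem_ball, dist_zero_right]; linarith)
  rw [← eLpNorm_congr_ae (coe_ae_eq_toFun f)] at h
  have h2 := ENNReal.toReal_mono (Lp.memLp f.1).2.ne h
  rw [ENNReal.toReal_mul, toReal_enorm] at h2
  rw [le_inv_mul_iff₀ hcr]
  exact h2

theorem exists_reproducingKernel {α : ℝ} (hα : -1 < α) {z : ℂ} (hz : z ∈ ball (0 : ℂ) 1) :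
    ∃ K : bergmanSpace α, ∀ f, inner ℂ K f = toFun f z := by
  obtain ⟨L, hL⟩ := exists_evalCLM hα hz
  exact ⟨(InnerProductSpace.toDual ℂ (bergmanSpace α)).symm L, fun f => by
    rw [InnerProductSpace.toDual_symm_apply, hL]⟩

theorem toFun_sum_smul_monomial {α : ℝ} (hα : -1 < α) {z : ℂ} (hz : z ∈ ball (0 : ℂ) 1) (N : ℕ)
    (c : ℕ → ℂ) : toFun (∑ m ∈ Finset.range N, c m • monomial hα m) z =
      ∑ m ∈ Finset.range N, c m * z ^ m := by
  obtain ⟨L, hL⟩ := exists_evalCLM hα hz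
  rw [← hL, map_sum]
  refine Finset.sum_congr rfl fun m _ => ?_
  rw [map_smul, hL, toFun_monomial hα m hz, smul_eq_mul]

/-- Let `p` be the Taylor polynomial that the kernel should have. Then `p(z) = ‖p‖² = F`, and
Cauchy–Schwarz for `⟪K, p⟫ = p(z)` gives `F² ≤ ‖K‖² F`. Only this lower bound for `‖K‖` is needed,
so the kernel itself is never computed. -/
theorem sum_pow_div_bergmanWeight_le {α : ℝ} (hα : -1 < α) {z : ℂ} (hz : z ∈ ball (0 : ℂ) 1)
    {K : bergmanSpace α} (hK : ∀ f, inner ℂ K f = toFun f z) (N : ℕ) :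
    ∑ n ∈ Finset.range N, (‖z‖ ^ 2) ^ n / bergmanWeight α n ≤ ‖K‖ ^ 2 := by
  set F := ∑ n ∈ Finset.range N, (‖z‖ ^ 2) ^ n / bergmanWeight α n with hF
  have hF0 : 0 ≤ F := Finset.sum_nonneg fun n _ => by
    have := bergmanWeight_pos hα n
    positivity
  set c : ℕ → ℂ := fun n => star z ^ n / bergmanWeight α n with hc
  set p := ∑ m ∈ Finset.range N, c m • monomial hα m with hp
  have h1 : toFun p z = F := by
    rw [hp, toFun_sum_smul_monomial hα hz, hF, Complex.ofReal_sum]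
    refine Finset.sum_congr rfl fun n _ => ?_
    rw [hc]
    push_cast
    rw [div_mul_eq_mul_div, ← mul_pow, Complex.star_def, Complex.conj_mul']
  have hcp : ∀ n, coeff p n = if n < N then c n else 0 := coeff_sum_smul_monomial hα N c
  have h2 : ‖p‖ ^ 2 = F := by
    have : HasSum (fun n => ‖coeff p n‖ ^ 2 * bergmanWeight α n)
        (∑ n ∈ Finset.range N, ‖coeff p n‖ ^ 2 * bergmanWeight α n) :=
      hasSum_sum_of_ne_finset_zero fun n hn => by
        rw [hcp, if_neg (by simpa using hn), norm_zero, zero_pow two_ne_zero, zero_mul]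
    refine ((hasSum_norm_sq hα p).unique this).trans ?_
    refine Finset.sum_congr rfl fun n hn => ?_
    have hw := bergmanWeight_pos hα n
    rw [hcp, if_pos (Finset.mem_range.1 hn), hc, norm_div, norm_pow, norm_star, Complex.norm_real,
      Real.norm_eq_abs, abs_of_pos hw]
    field_simp
    ring
  have h3 := norm_inner_le_norm (𝕜 := ℂ) K p
  rw [hK, h1, Complex.norm_real, Real.norm_eq_abs, abs_of_nonneg hF0] at h3
  have h4 : F ^ 2 ≤ ‖K‖ ^ 2 * F := by
    rw [← h2, ← mul_pow, h2]
    exact pow_le_pow_left₀ hF0 h3 2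
  rcases hF0.eq_or_lt with h0 | h0
  · rw [← h0]; positivity
  · exact le_of_mul_le_mul_right (by linarith) h0

theorem lintegral_rpow_mul_exp_neg_mul {s c : ℝ} (hs : 0 < s) (hc : 0 < c) :
    ∫⁻ t in Ioi (0 : ℝ), ENNReal.ofReal (t ^ (s - 1) * Real.exp (-(c * t))) =
      ENNReal.ofReal ((1 / c) ^ s * Real.Gamma s) := by
  rw [← Real.integral_rpow_mul_exp_neg_mul_Ioi hs hc, ofReal_integral_eq_lintegral_ofReal]
  -- A non-integrable function would have integral zero, but the known value is positive.
  · by_contra hcon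
    have h1 := Real.integral_rpow_mul_exp_neg_mul_Ioi hs hc
    rw [integral_undef hcon] at h1
    have := Real.Gamma_pos_of_pos hs
    have : 0 < (1 / c) ^ s * Real.Gamma s := by positivity
    linarith
  · exact ae_restrict_of_forall_mem measurableSet_Ioi fun t ht =>
      mul_nonneg (Real.rpow_nonneg (le_of_lt ht) _) (Real.exp_pos _).le

theorem bergmanWeight_eq {α : ℝ} (hα : -1 < α) (n : ℕ) :
    bergmanWeight α n = n.factorial * Real.Gamma (α + 2) / Real.Gamma (n + (α + 2)) := by
  rw [bergmanWeight, ProbabilityTheory.beta, Real.Gamma_nat_eq_factorial,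
    show α + 2 = (α + 1) + 1 by ring, Real.Gamma_add_one (by linarith : α + 1 ≠ 0).symm.symm,
    show (n : ℝ) + 1 + (α + 1) = n + (α + 1 + 1) by ring]
  ring

/-- The generating function of the reciprocals of the weights, which is the reproducing kernel on
the diagonal. -/
theorem tsum_pow_div_bergmanWeight {α : ℝ} (hα : -1 < α) {x : ℝ} (h0 : 0 ≤ x) (h1 : x < 1) :
    ∑' n : ℕ, ENNReal.ofReal (x ^ n / bergmanWeight α n) =
      ENNReal.ofReal ((1 / (1 - x)) ^ (α + 2)) := by
  have hs : 0 < α + 2 := by linarith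
  have hG := Real.Gamma_pos_of_pos hs
  -- The reciprocal weight is `Γ(n + α + 2) / (n! Γ(α + 2))`. Writing the numerator as a Gamma
  -- integral lets the series be summed under the integral sign to `exp (x t)`, which leaves another
  -- Gamma integral.
  have hterm : ∀ n : ℕ, ENNReal.ofReal (Real.Gamma (α + 2)) *
      ENNReal.ofReal (x ^ n / bergmanWeight α n) = ∫⁻ t in Ioi (0 : ℝ),
        ENNReal.ofReal ((x * t) ^ n / n.factorial * (t ^ (α + 2 - 1) * Real.exp (-(1 * t)))) := by
    intro n
    have hn : 0 < (n : ℝ) + (α + 2) := by positivity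
    have e : ∀ t ∈ Ioi (0 : ℝ), ENNReal.ofReal ((x * t) ^ n / n.factorial *
        (t ^ (α + 2 - 1) * Real.exp (-(1 * t)))) = ENNReal.ofReal (x ^ n / n.factorial) *
          ENNReal.ofReal (t ^ (n + (α + 2) - 1) * Real.exp (-(1 * t))) := by
      intro t ht
      rw [← ENNReal.ofReal_mul (by positivity),
        show (n : ℝ) + (α + 2) - 1 = n + (α + 2 - 1) by ring, Real.rpow_add ht, Real.rpow_natCast]
      congr 1
      ring
    rw [setLIntegral_congr_fun measurableSet_Ioi e, lintegral_const_mul' _ _ ENNReal.ofReal_ne_top,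
      lintegral_rpow_mul_exp_neg_mul hn one_pos, ← ENNReal.ofReal_mul hG.le,
      ← ENNReal.ofReal_mul (by positivity), bergmanWeight_eq hα]
    have := (Real.Gamma_pos_of_pos hn).ne'
    congr 1
    rw [div_one, Real.one_rpow]
    field_simp
  have hG' : ENNReal.ofReal (Real.Gamma (α + 2)) ≠ 0 := by simpa using hG
  refine (ENNReal.mul_right_inj hG' ENNReal.ofReal_ne_top).1 ?_
  rw [← ENNReal.tsum_mul_left, tsum_congr hterm, ← lintegral_tsum fun n => by fun_prop]
  have e : ∀ t ∈ Ioi (0 : ℝ), (∑' n : ℕ, ENNReal.ofReal ((x * t) ^ n / n.factorial *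
      (t ^ (α + 2 - 1) * Real.exp (-(1 * t))))) =
        ENNReal.ofReal (t ^ (α + 2 - 1) * Real.exp (-((1 - x) * t))) := by
    intro t ht
    have ht0 : 0 < t := ht
    have hexp : HasSum (fun n : ℕ => (x * t) ^ n / n.factorial) (Real.exp (x * t)) := by
      rw [Real.exp_eq_exp_ℝ]
      exact NormedSpace.expSeries_div_hasSum_exp (x * t)
    have hsum := hexp.mul_right (t ^ (α + 2 - 1) * Real.exp (-(1 * t)))
    rw [← ENNReal.ofReal_tsum_of_nonneg (fun n => by positivity) hsum.summable, hsum.tsum_eq,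
      mul_left_comm, ← Real.exp_add]
    congr 3
    ring
  rw [setLIntegral_congr_fun measurableSet_Ioi e, lintegral_rpow_mul_exp_neg_mul hs (by linarith),
    ← ENNReal.ofReal_mul hG.le, mul_comm]

theorem rpow_le_norm_reproducingKernel_sq {α : ℝ} (hα : -1 < α) {z : ℂ}
    (hz : z ∈ ball (0 : ℂ) 1) {K : bergmanSpace α} (hK : ∀ f, inner ℂ K f = toFun f z) :
    (1 / (1 - ‖z‖ ^ 2)) ^ (α + 2) ≤ ‖K‖ ^ 2 := by
  have hz' : ‖z‖ < 1 := by simpa using hz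
  rw [← ENNReal.ofReal_le_ofReal_iff (by positivity),
    ← tsum_pow_div_bergmanWeight hα (by positivity) (by nlinarith [norm_nonneg z])]
  refine ENNReal.tsum_le_of_sum_range_le fun N => ?_
  rw [← ENNReal.ofReal_sum_of_nonneg fun n _ => by have := bergmanWeight_pos hα n; positivity]
  exact ENNReal.ofReal_le_ofReal (sum_pow_div_bergmanWeight_le hα hz hK N)

theorem one_le_norm_reproducingKernel {α : ℝ} (hα : -1 < α) {z : ℂ}
    (hz : z ∈ ball (0 : ℂ) 1) {K : bergmanSpace α} (hK : ∀ f, inner ℂ K f = toFun f z) :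
    1 ≤ ‖K‖ := by
  have hz' : ‖z‖ < 1 := by simpa using hz
  have h1 : 0 < 1 - ‖z‖ ^ 2 := by nlinarith [norm_nonneg z]
  have h2 : 1 ≤ (1 / (1 - ‖z‖ ^ 2)) ^ (α + 2) :=
    Real.one_le_rpow (by rw [le_div_iff₀ h1]; nlinarith [norm_nonneg z]) (by linarith)
  have h3 := h2.trans (rpow_le_norm_reproducingKernel_sq hα hz hK)
  nlinarith [norm_nonneg K]

/-- The normalized reproducing kernels tend weakly to zero at the circle. -/
theorem tendsto_inner_normalized_kernel {α : ℝ} (hα : -1 < α) {z : ℕ → ℂ}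
    (hz : ∀ n, z n ∈ ball (0 : ℂ) 1) (hz1 : Tendsto (fun n => ‖z n‖) atTop (𝓝 1))
    {K : ℕ → bergmanSpace α} (hK : ∀ n f, inner ℂ (K n) f = toFun f (z n)) (f : bergmanSpace α) :
    Tendsto (fun n => ‖toFun f (z n)‖ / ‖K n‖) atTop (𝓝 0) := by
  have hK0 : ∀ n, 0 < ‖K n‖ := fun n =>
    one_pos.trans_le (one_le_norm_reproducingKernel hα (hz n) (hK n))
  have hinv : Tendsto (fun n => ‖K n‖⁻¹) atTop (𝓝 0) := by
    have h1 : Tendsto (fun n => √((1 - ‖z n‖ ^ 2) ^ (α + 2))) atTop (𝓝 0) := by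
      have h2 : Tendsto (fun n => 1 - ‖z n‖ ^ 2) atTop (𝓝 0) := by
        simpa using (hz1.pow 2).const_sub 1
      have h3 := h2.rpow_const (p := α + 2) (Or.inr (by linarith))
      rw [Real.zero_rpow (by linarith)] at h3
      simpa using h3.sqrt
    refine squeeze_zero (fun n => inv_nonneg.2 (norm_nonneg _)) (fun n => ?_) h1
    have hz' : ‖z n‖ < 1 := by simpa using hz n
    have h4 : 0 < 1 - ‖z n‖ ^ 2 := by nlinarith [norm_nonneg (z n)]
    have h5 := rpow_le_norm_reproducingKernel_sq hα (hz n) (hK n)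
    rw [one_div, Real.inv_rpow h4.le] at h5
    refine Real.le_sqrt_of_sq_le ?_
    rw [inv_pow]
    exact inv_le_of_inv_le₀ (Real.rpow_pos_of_pos h4 _) h5
  -- Polynomials are bounded on the disk while `‖K n‖ → ∞`. The general case follows by density,
  -- since the quotient for `f - p` is at most `‖f - p‖`.
  have hpoly : ∀ N, Tendsto (fun n => ‖toFun (truncation hα N f) (z n)‖ / ‖K n‖) atTop (𝓝 0) := by
    intro N
    have h := hinv.const_mul (∑ m ∈ Finset.range N, ‖coeff f m‖)
    rw [mul_zero] at h
    refine squeeze_zero (fun n => by positivity) (fun n => ?_) h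
    have hz' : ‖z n‖ < 1 := by simpa using hz n
    rw [div_eq_mul_inv, truncation_apply, toFun_sum_smul_monomial hα (hz n)]
    gcongr
    refine (norm_sum_le _ _).trans (Finset.sum_le_sum fun m _ => ?_)
    rw [norm_mul, norm_pow]
    exact mul_le_of_le_one_right (norm_nonneg _) (pow_le_one₀ (norm_nonneg _) hz'.le)
  rw [Metric.tendsto_atTop]
  intro ε hε
  obtain ⟨N, hN⟩ := (Metric.tendsto_atTop.1 (tendsto_truncation hα f)) (ε / 2) (half_pos hε)
  obtain ⟨M, hM⟩ := (Metric.tendsto_atTop.1 (hpoly N)) (ε / 2) (half_pos hε)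
  refine ⟨M, fun n hn => ?_⟩
  have h1 := hM n hn
  have h2 := hN N le_rfl
  rw [Real.dist_0_eq_abs, abs_of_nonneg (by positivity)] at h1 ⊢
  rw [dist_eq_norm, norm_sub_rev] at h2
  have h3 : ‖toFun f (z n)‖ ≤ ‖toFun (truncation hα N f) (z n)‖ +
      ‖K n‖ * ‖f - truncation hα N f‖ := by
    rw [← hK, ← hK]
    have h4 := inner_add_right (𝕜 := ℂ) (K n) (truncation hα N f) (f - truncation hα N f)
    rw [add_sub_cancel] at h4
    rw [h4]
    exact (norm_add_le _ _).trans (add_le_add le_rfl (norm_inner_le_norm (𝕜 := ℂ) _ _))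
  rw [div_lt_iff₀ (hK0 n)] at h1 ⊢
  nlinarith [hK0 n]

/-! ### Compactness of the defect operator and the boundary behaviour of the symbol -/

theorem ofReal_sq_div_four_le_lintegral {R : ℝ} (hR : 0 < R) :
    ENNReal.ofReal (R ^ 2 / 4) ≤ ∫⁻ r in Ioo 0 R, ENNReal.ofReal r := by
  calc ENNReal.ofReal (R ^ 2 / 4) = ∫⁻ _ in Ioo (R / 2) R, ENNReal.ofReal (R / 2) := by
        rw [setLIntegral_const, Real.volume_Ioo, ← ENNReal.ofReal_mul (by positivity)]
        congr 1
        ring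
    _ ≤ ∫⁻ r in Ioo (R / 2) R, ENNReal.ofReal r :=
        setLIntegral_mono' measurableSet_Ioo fun r hr => ENNReal.ofReal_le_ofReal hr.1.le
    _ ≤ _ := lintegral_mono_set (Ioo_subset_Ioo_left (by positivity))

/-- A lower bound for the weight near a point, in terms of the distance from the circle. -/
theorem mul_rpow_le_one_sub_norm_sq_rpow {α t : ℝ} {w z : ℂ} (ht : 0 < t) (hw : ‖w‖ = 1 - t)
    (hz : ‖z - w‖ < t / 2) :
    min ((1 / 2) ^ α) (3 ^ α) * t ^ α ≤ (1 - ‖z‖ ^ 2) ^ α := by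
  have h1 : ‖z‖ ≤ ‖z - w‖ + ‖w‖ := by simpa using norm_add_le (z - w) w
  have h2 : ‖w‖ ≤ ‖z - w‖ + ‖z‖ := by
    rw [norm_sub_rev]; simpa using norm_add_le (w - z) z
  have hz0 := norm_nonneg z
  -- Here `1 - ‖z‖` lies between `t / 2` and `3 t / 2`, and `1 + ‖z‖` between 1 and 2. The minimum
  -- in the statement covers both signs of `α`.
  have h3 : 1 / 2 * t ≤ 1 - ‖z‖ ^ 2 := by nlinarith
  have h4 : 1 - ‖z‖ ^ 2 ≤ 3 * t := by nlinarith
  have htα : 0 ≤ t ^ α := Real.rpow_nonneg ht.le _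
  have h5 : 0 < 1 - ‖z‖ ^ 2 := by linarith
  rcases le_total 0 α with hα | hα
  · calc _ ≤ (1 / 2) ^ α * t ^ α := by gcongr; exact min_le_left _ _
      _ = (1 / 2 * t) ^ α := (Real.mul_rpow (by norm_num) ht.le).symm
      _ ≤ _ := Real.rpow_le_rpow (by positivity) h3 hα
  · calc _ ≤ 3 ^ α * t ^ α := by gcongr; exact min_le_right _ _
      _ = (3 * t) ^ α := (Real.mul_rpow (by norm_num) ht.le).symm
      _ ≤ _ := Real.rpow_le_rpow_of_nonpos h5 h4 hα

/-- A lower bound for the defect operator on functions that are large at a given point. -/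
theorem exists_le_norm_defectConj_sq {α : ℝ} (hα : -1 < α) {φ : ℂ → ℂ} (hφ : φ ∈ hInftyBall)
    (hlt : ∀ z ∈ ball (0 : ℂ) 1, ‖φ z‖ < 1) : ∃ c > 0, ∀ w ∈ ball (0 : ℂ) 1,
      ∀ f : bergmanSpace α, c * (1 - ‖φ w‖ ^ 2) * (1 - ‖w‖) ^ (α + 2) * ‖toFun f w‖ ^ 2 ≤
        ‖defectConj α hφ f‖ ^ 2 := by
  set m : ℝ := min ((1 / 2) ^ α) (3 ^ α) with hm
  have hm0 : 0 < m := lt_min (by positivity) (by positivity)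
  have hpi := Real.pi_pos
  have hα1 : 0 < α + 1 := by linarith
  -- `3 / 256` is `3 / 16`, from Schwarz–Pick at relative radius at most `1 / 2`, times `1 / 16`,
  -- from `(t / 2) ^ 2 / 4` in the mean value inequality. The rest bounds the weight.
  refine ⟨3 / 256 * ((α + 1) / Real.pi * m), by positivity, fun w hw f => ?_⟩
  obtain ⟨t, ht⟩ : ∃ t, t = 1 - ‖w‖ := ⟨_, rfl⟩
  have hw' : ‖w‖ < 1 := by simpa using hw
  have ht0 : 0 < t := by linarith
  have hsub : ball w t ⊆ ball 0 1 := by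
    intro z hz
    have h1 : ‖z - w‖ < t := by simpa [dist_eq_norm] using hz
    have h2 : ‖z‖ ≤ ‖z - w‖ + ‖w‖ := by simpa using norm_add_le (z - w) w
    rw [mem_ball, dist_zero_right]
    linarith
  have hsub2 : ball w (t / 2) ⊆ ball w t := ball_subset_ball (by linarith)
  have hφw : 0 < 1 - ‖φ w‖ ^ 2 := by nlinarith [hlt w hw, norm_nonneg (φ w)]
  have hf := differentiableOn_toFun f
  -- The mean is taken over half the radius, while Schwarz–Pick uses the full disk `ball w t`; this
  -- keeps `‖z - w‖ / t` away from 1.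
  have mv := mean_value (h := fun z => toFun f z ^ 2) (z := w) (R := t / 2)
    ((hf.mono (hsub2.trans hsub)).pow 2)
  simp only [enorm_pow] at mv
  have hlow : ∀ z ∈ ball w (t / 2), ENNReal.ofReal ((α + 1) / Real.pi * (m * t ^ α)) *
      (‖toFun f z‖ₑ ^ 2 * ENNReal.ofReal (3 / 16 * (1 - ‖φ w‖ ^ 2))) ≤
      ENNReal.ofReal ((α + 1) / Real.pi * (1 - ‖z‖ ^ 2) ^ α) *
        (‖toFun f z‖ₑ ^ 2 * ENNReal.ofReal (1 - ‖φ z‖ ^ 2)) := by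
    intro z hz
    have h1 : ‖z - w‖ < t / 2 := by simpa [dist_eq_norm] using hz
    have h2 := le_one_sub_norm_sq_of_mem_ball (hφ.1.mono hsub) (fun u hu => hlt u (hsub hu))
      (hsub2 hz)
    have h3 : ‖z - w‖ / t ≤ 1 / 2 := by rw [div_le_iff₀ ht0]; linarith
    have h4 : (‖z - w‖ / t) ^ 2 ≤ 1 / 4 := by
      have : 0 ≤ ‖z - w‖ / t := by positivity
      nlinarith
    have h5 : 3 / 16 * (1 - ‖φ w‖ ^ 2) ≤ 1 - ‖φ z‖ ^ 2 := by nlinarith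
    have h6 := mul_rpow_le_one_sub_norm_sq_rpow (α := α) ht0 (by linarith) h1
    gcongr
  rw [← ht, ← ENNReal.ofReal_le_ofReal_iff (by positivity), ofReal_norm_defectConj_sq hα,
    lintegral_bergmanMeasure]
  have htα : 0 ≤ t ^ α := Real.rpow_nonneg ht0.le _
  calc ENNReal.ofReal (3 / 256 * ((α + 1) / Real.pi * m) * (1 - ‖φ w‖ ^ 2) * t ^ (α + 2) *
        ‖toFun f w‖ ^ 2)
      = ENNReal.ofReal ((α + 1) / Real.pi * (m * t ^ α)) *
          (ENNReal.ofReal ((t / 2) ^ 2 / 4) * ‖toFun f w‖ₑ ^ 2 *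
            ENNReal.ofReal (3 / 16 * (1 - ‖φ w‖ ^ 2))) := by
        rw [← ofReal_norm, ← ENNReal.ofReal_pow (norm_nonneg _),
          ← ENNReal.ofReal_mul (by positivity), ← ENNReal.ofReal_mul (by positivity),
          ← ENNReal.ofReal_mul (by positivity), Real.rpow_add ht0, Real.rpow_two]
        congr 1
        ring
    _ ≤ ENNReal.ofReal ((α + 1) / Real.pi * (m * t ^ α)) *
          ((∫⁻ z in ball w (t / 2), ‖toFun f z‖ₑ ^ 2) *
            ENNReal.ofReal (3 / 16 * (1 - ‖φ w‖ ^ 2))) := by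
        gcongr
        refine le_trans ?_ mv
        gcongr
        exact ofReal_sq_div_four_le_lintegral (by positivity)
    _ = ∫⁻ z in ball w (t / 2), ENNReal.ofReal ((α + 1) / Real.pi * (m * t ^ α)) *
          (‖toFun f z‖ₑ ^ 2 * ENNReal.ofReal (3 / 16 * (1 - ‖φ w‖ ^ 2))) := by
        rw [lintegral_const_mul' _ _ ENNReal.ofReal_ne_top,
          lintegral_mul_const' _ _ ENNReal.ofReal_ne_top]
    _ ≤ ∫⁻ z in ball w (t / 2), ENNReal.ofReal ((α + 1) / Real.pi * (1 - ‖z‖ ^ 2) ^ α) *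
          (‖toFun f z‖ₑ ^ 2 * ENNReal.ofReal (1 - ‖φ z‖ ^ 2)) :=
        setLIntegral_mono' measurableSet_ball hlow
    _ ≤ _ := lintegral_mono_set (hsub2.trans hsub)

/-- Since `K(w) = ‖K‖²`, the preceding bound contains `(1 - ‖w‖) ^ (α + 2) * ‖K‖⁴`. The lower bound
for `‖K‖²` absorbs the power of `1 - ‖w‖`, because `(1 - ‖w‖) / (1 - ‖w‖²) ≥ 1 / 2`. -/
theorem exists_le_norm_defectConj_kernel_sq {α : ℝ} (hα : -1 < α) {φ : ℂ → ℂ}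
    (hφ : φ ∈ hInftyBall) (hlt : ∀ z ∈ ball (0 : ℂ) 1, ‖φ z‖ < 1) :
    ∃ c > 0, ∀ w ∈ ball (0 : ℂ) 1, ∀ K : bergmanSpace α, (∀ f, inner ℂ K f = toFun f w) →
      c * (1 - ‖φ w‖ ^ 2) * ‖K‖ ^ 2 ≤ ‖defectConj α hφ K‖ ^ 2 := by
  obtain ⟨c, hc, h⟩ := exists_le_norm_defectConj_sq hα hφ hlt
  refine ⟨c * (1 / 2) ^ (α + 2), by positivity, fun w hw K hK => ?_⟩
  have hw' : ‖w‖ < 1 := by simpa using hw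
  have h1 := rpow_le_norm_reproducingKernel_sq hα hw hK
  have hφw : 0 < 1 - ‖φ w‖ ^ 2 := by nlinarith [hlt w hw, norm_nonneg (φ w)]
  have h2 : (1 / 2) ^ (α + 2) ≤ (1 - ‖w‖) ^ (α + 2) * ‖K‖ ^ 2 := by
    have h3 : 0 < 1 - ‖w‖ := by linarith
    have h4 : 0 < 1 - ‖w‖ ^ 2 := by nlinarith [norm_nonneg w]
    calc (1 / 2 : ℝ) ^ (α + 2) ≤ ((1 - ‖w‖) * (1 / (1 - ‖w‖ ^ 2))) ^ (α + 2) := by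
          refine Real.rpow_le_rpow (by positivity) ?_ (by linarith)
          rw [mul_one_div, div_le_div_iff₀ two_pos h4]
          nlinarith [norm_nonneg w]
      _ = (1 - ‖w‖) ^ (α + 2) * (1 / (1 - ‖w‖ ^ 2)) ^ (α + 2) :=
          Real.mul_rpow h3.le (by positivity)
      _ ≤ _ := by gcongr
  have h5 : ‖toFun K w‖ = ‖K‖ ^ 2 := by
    have h6 := inner_self_eq_norm_sq_to_K (𝕜 := ℂ) K
    rw [← hK, h6, norm_pow]
    simp
  refine le_trans ?_ (h w hw K)
  rw [h5]
  calc _ = c * (1 - ‖φ w‖ ^ 2) * ‖K‖ ^ 2 * (1 / 2) ^ (α + 2) := by ring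
    _ ≤ c * (1 - ‖φ w‖ ^ 2) * ‖K‖ ^ 2 * ((1 - ‖w‖) ^ (α + 2) * ‖K‖ ^ 2) := by gcongr
    _ = _ := by ring

/-- Otherwise `1 - ‖φ‖² ≥ ε` along points tending to the circle. The images of the normalized
kernels at these points tend weakly to zero but stay bounded below in norm, which compactness
forbids. -/
theorem boundaryUnimodular_of_isCompactOperator {α : ℝ} (hα : -1 < α) {φ : ℂ → ℂ}
    (hφ : φ ∈ hInftyBall) (hlt : ∀ z ∈ ball (0 : ℂ) 1, ‖φ z‖ < 1)
    (hc : IsCompactOperator (defectConj α hφ)) : BoundaryUnimodular φ := by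
  by_contra hcon
  rw [BoundaryUnimodular] at hcon
  push Not at hcon
  obtain ⟨ε, hε, hcon⟩ := hcon
  choose z hz hz1 hzφ using fun n : ℕ => hcon (1 - 1 / ((n : ℝ) + 1)) (by
    have : 0 < 1 / ((n : ℝ) + 1) := by positivity
    linarith)
  have hz' : ∀ n, ‖z n‖ < 1 := fun n => by simpa using hz n
  have hlim : Tendsto (fun n => ‖z n‖) atTop (𝓝 1) := by
    have h1 := (tendsto_one_div_add_atTop_nhds_zero_nat (𝕜 := ℝ)).const_sub 1
    rw [sub_zero] at h1
    exact tendsto_of_tendsto_of_tendsto_of_le_of_le h1 tendsto_const_nhds (fun n => (hz1 n).le)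
      fun n => (hz' n).le
  choose K hK using fun n => exists_reproducingKernel hα (hz n)
  obtain ⟨c, hc0, hck⟩ := exists_le_norm_defectConj_kernel_sq hα hφ hlt
  have hK0 : ∀ n, 0 < ‖K n‖ := fun n =>
    one_pos.trans_le (one_le_norm_reproducingKernel hα (hz n) (hK n))
  set D := defectConj α hφ
  set κ : ℕ → bergmanSpace α := fun n => ((‖K n‖⁻¹ : ℝ) : ℂ) • K n with hκ
  have hκ1 : ∀ n, κ n ∈ closedBall (0 : bergmanSpace α) 1 := by
    intro n
    rw [mem_closedBall, dist_zero_right, hκ, norm_smul, Complex.norm_real, norm_inv, norm_norm,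
      inv_mul_cancel₀ (hK0 n).ne']
  have hlow : ∀ n, c * ε ≤ ‖D (κ n)‖ ^ 2 := by
    intro n
    have h1 := hck (z n) (hz n) (K n) (hK n)
    have h2 : ε ≤ 1 - ‖φ (z n)‖ ^ 2 := by
      nlinarith [hzφ n, norm_nonneg (φ (z n)), hlt _ (hz n)]
    rw [hκ, map_smul, norm_smul, Complex.norm_real, norm_inv, norm_norm, mul_pow, inv_pow,
      inv_mul_eq_div, le_div_iff₀ (pow_pos (hK0 n) 2)]
    refine le_trans ?_ h1
    gcongr
  have hweak : ∀ g, Tendsto (fun n => inner ℂ (D (κ n)) g) atTop (𝓝 0) := by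
    intro g
    rw [tendsto_zero_iff_norm_tendsto_zero]
    refine (tendsto_inner_normalized_kernel hα hz hlim hK (D g)).congr fun n => ?_
    have h1 := inner_smul_left (𝕜 := ℂ) (K n) (D g) ((‖K n‖⁻¹ : ℝ) : ℂ)
    rw [inner_defectConj_left, hκ, h1, hK, norm_mul, Complex.conj_ofReal, Complex.norm_real,
      norm_inv, norm_norm, inv_mul_eq_div]
  obtain ⟨S, hS, hDS⟩ := hc.image_closedBall_subset_compact (𝕜₁ := ℂ) (f := D.toLinearMap) 1
  -- Compactness gives a norm limit `y` of a subsequence; the weak limit zero forces `⟪y, y⟫ = 0`.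
  obtain ⟨y, -, ψ, hψ, hy⟩ := hS.tendsto_subseq fun n => hDS ⟨κ n, hκ1 n, rfl⟩
  have hy' : Tendsto (fun n => D (κ (ψ n))) atTop (𝓝 y) := hy
  have hy0 : y = 0 := by
    refine inner_self_eq_zero (𝕜 := ℂ).1 ?_
    exact tendsto_nhds_unique (hy'.inner tendsto_const_nhds) ((hweak y).comp hψ.tendsto_atTop)
  have hn := (hy'.norm).pow 2
  rw [hy0, norm_zero, zero_pow two_ne_zero] at hn
  have := ge_of_tendsto' hn fun n => hlow (ψ n)
  have := mul_pos hc0 hε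
  linarith

theorem subBergmanConj_eq_of_isFiniteBlaschke {α : ℝ} (hα : -1 < α) {φ : ℂ → ℂ}
    (hφ : φ ∈ hInftyBall) (hlt : ∀ z ∈ ball (0 : ℂ) 1, ‖φ z‖ < 1) (hB : IsFiniteBlaschke φ) :
    subBergmanConj α hφ = subBergmanConj α id_mem_hInftyBall := by
  obtain ⟨C, hC, hle⟩ := hB.one_sub_norm_sq_le
  have h0 : 0 < 1 - ‖φ 0‖ ^ 2 := by
    nlinarith [hlt 0 (mem_ball_self one_pos), norm_nonneg (φ 0)]
  have hge : ∀ z ∈ ball (0 : ℂ) 1, 1 - ‖z‖ ^ 2 ≤ (4 / (1 - ‖φ 0‖ ^ 2)) * (1 - ‖φ z‖ ^ 2) := by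
    intro z hz
    have := le_one_sub_norm_sq hφ hlt hz
    rw [div_mul_eq_mul_div, le_div_iff₀ h0]
    linarith
  have h1 := norm_defectConj_sq_le hα hφ id_mem_hInftyBall hC hle
  have h2 := norm_defectConj_sq_le hα id_mem_hInftyBall hφ (by positivity) hge
  ext g
  constructor
  · rintro ⟨hg, f, hf⟩
    obtain ⟨x, hx⟩ := mem_range_defectConj_of_le h1 ⟨f, rfl⟩
    exact ⟨hg, x, hx ▸ hf⟩
  · rintro ⟨hg, f, hf⟩
    obtain ⟨x, hx⟩ := mem_range_defectConj_of_le h2 ⟨f, rfl⟩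
    exact ⟨hg, x, hx ▸ hf⟩

/-- Inclusion of the function spaces is inclusion of the operator ranges, so `D` factors through the
compact injective operator of the symbol `z`. -/
theorem isCompactOperator_of_subBergmanConj_subset {α : ℝ} (hα : -1 < α) {φ : ℂ → ℂ}
    (hφ : φ ∈ hInftyBall) (h : subBergmanConj α hφ ⊆ subBergmanConj α id_mem_hInftyBall) :
    IsCompactOperator (defectConj α hφ) := by
  refine isCompactOperator_of_range_subset (isCompactOperator_defectConj_id hα)
    (injective_defectConj_id hα) fun f => ?_
  obtain ⟨-, x, hx⟩ := h ⟨differentiableOn_toFun (defectConj α hφ f), f, coe_ae_eq_toFun _⟩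
  exact ⟨x, Subtype.ext (Lp.ext (hx.trans (coe_ae_eq_toFun _).symm))⟩

end

end SubBergman

open SubBergman in
theorem theorem14 (α : ℝ) (hα : -1 < α) (k : ℕ) (hk : -1 < 2 * (k : ℝ) + (α - 1))
    (φ : ℂ → ℂ) (hφ : φ ∈ hInftyBall)
    (hne : ¬ ∃ c : ℂ, ‖c‖ = 1 ∧ ∀ z ∈ Metric.ball (0 : ℂ) 1, φ z = c) :
    List.TFAE [
      IsCompactOperator (defectConj α hφ),
      IsFiniteBlaschke φ,
      subBergmanConj α hφ = genBergman (α - 1) k,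
      subBergmanConj α hφ ⊆ genBergman (α - 1) k] := by
  have hlt := norm_lt_one_of_not_const hφ hne
  -- From here on `A²_{α-1}` is the range for the symbol `z`, and `k` has disappeared.
  rw [← subBergmanConj_id_eq hα hk]
  tfae_have 1 → 2 := fun h => isFiniteBlaschke_of_boundaryUnimodular hφ
    (boundaryUnimodular_of_isCompactOperator hα hφ hlt h)
  tfae_have 2 → 3 := subBergmanConj_eq_of_isFiniteBlaschke hα hφ hlt
  tfae_have 3 → 4 := fun h => h.subset
  tfae_have 4 → 1 := isCompactOperator_of_subBergmanConj_subset hα hφ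
  tfae_finish
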